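/- Let $\mathfrak L$ be the affine-Virasoro algebra of type $A_1$: the complex Lie algebra with basis $\{e_i,f_i,h_i,d_i,C\mid i\in\mathbb Z\}$ and brackets $$[e_i,f_j]=h_{i+j}+i\delta_{i+j,0}C,\quad [h_i,e_j]=2e_{i+j},\quad [h_i,f_j]=-2f_{i+j},\quad [h_i,h_j]=2i\delta_{i+j,0}C,$$ $$[d_i,d_j]=(j-i)d_{i+j}+\delta_{i+j,0}\tfrac{i^3-i}{12}C,\quad [d_i,x_j]=jx_{i+j}\ (x\in\{e,f,h\}),\quad [e_i,e_j]=[f_i,f_j]=[C,\mathfrak L]=0 .$$ Let $\lambda,\alpha\in\mathbb C^*$ and $\beta,\gamma,\eta,\varepsilon,\theta\in\mathbb C$. For $M\in\{\Omega,\Delta,\Theta\}$ define polynomials in $t$ by $$E_\Omega=\alpha,\quad F_\Omega=-\tfrac1\alpha(\tfrac t2-\beta)(\tfrac t2+\beta+1);\qquad E_\Delta=-\tfrac1\alpha(\tfrac t2+\beta)(\tfrac t2-\beta-1),\quad F_\Delta=\alpha;$$ $$E_\Theta=\alpha(\tfrac t2+\beta),\quad F_\Theta=-\tfrac1\alpha(\tfrac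 t2-\beta).$$ Let $M(\lambda,\alpha,\beta,\gamma)$ be the $\mathfrak L$-module with underlying space $\mathbb C[s,t]$ and, for $i\in\mathbb Z$, $$e_i\cdot p(s,t)=\lambda^iE_M(t)p(s-i,t-2),\quad f_i\cdot p(s,t)=\lambda^iF_M(t)p(s-i,t+2),\quad h_i\cdot p(s,t)=\lambda^i t\,p(s-i,t),$$ $$d_i\cdot p(s,t)=\lambda^i(s+i\gamma)p(s-i,t),\quad C\cdot p(s,t)=0 .$$ Let $\overline V(\eta,\varepsilon,\theta)=U(\mathfrak L)/I$ be the Verma module, where $I$ is the left ideal generated by $e_0$, by $e_i,f_i,h_i,d_i$ for $i\ge1$, and by $d_0-\eta,\ h_0-\varepsilon,\ C-\theta$. Let $\mathfrak b_\lambda\subset\mathfrak L$ be the subalgebra spanned by $d_m-\lambda^md_0$ and $f_m$ ($m\ge1$), $h_n$ and $e_n$ ($n\ge0$), and $C$. Let $\mathbb C[t]^M$ be the $\mathfrak b_\lambda$-module with underlying space $\mathbb C[t]$ and, for $m\ge1$, $n\ge0$, $$(d_m-\lambda^md_0)\circ p(t)=\lambda^m(m\gamma-\eta)p(t),\quad f_m\circ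 p(t)=\lambda^mF_M(t)p(t+2),\quad e_n\circ p(t)=\lambda^nE_M(t)p(t-2),$$ $$h_n\circ p(t)=\lambda^n(t+\delta_{n,0}\varepsilon)p(t),\quad C\circ p(t)=\theta p(t).$$ Then, for each $M\in\{\Omega,\Delta,\Theta\}$, there is an isomorphism of $\mathfrak L$-modules $$M(\lambda,\alpha,\beta,\gamma)\otimes\overline V(\eta,\varepsilon,\theta)\;\cong\;U(\mathfrak L)\otimes_{U(\mathfrak b_\lambda)}\mathbb C[t]^M .$$ -/

import Mathlib

open scoped TensorProduct

noncomputable section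

namespace AffineVirasoro

attribute [local instance 100] LieRing.ofAssociativeRing

/-- Labels of the standard basis `e i, f i, h i, d i` (`i : ℤ`) and `C`. -/
inductive Gen : Type
  | e (i : ℤ)
  | f (i : ℤ)
  | h (i : ℤ)
  | d (i : ℤ)
  | C

/-- The underlying complex vector space of the affine-Virasoro algebra of type `A₁`:
formal finite linear combinations of the basis labels. -/
def AffVir : Type := Gen →₀ ℂ

instance : AddCommGroup AffVir := inferInstanceAs (AddCommGroup (Gen →₀ ℂ))

instance : Module ℂ AffVir := inferInstanceAs (Module ℂ (Gen →₀ ℂ))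

/-- The standard basis of the affine-Virasoro algebra. -/
def basis : Module.Basis Gen ℂ AffVir := Module.Basis.ofRepr (LinearEquiv.refl ℂ (Gen →₀ ℂ))

/-- The basis vector `e_i`. -/
def e (i : ℤ) : AffVir := basis (Gen.e i)

/-- The basis vector `f_i`. -/
def f (i : ℤ) : AffVir := basis (Gen.f i)

/-- The basis vector `h_i`. -/
def h (i : ℤ) : AffVir := basis (Gen.h i)

/-- The basis vector `d_i`. -/
def d (i : ℤ) : AffVir := basis (Gen.d i)

/-- The central basis vector `C`. -/
def c : AffVir := basis Gen.C

/-- The brackets of the basis vectors. -/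
def table : Gen → Gen → AffVir
  | .e _, .e _ => 0
  | .f _, .f _ => 0
  | .e i, .f j => h (i + j) + (if i + j = 0 then (i : ℂ) else 0) • c
  | .f j, .e i => -(h (i + j) + (if i + j = 0 then (i : ℂ) else 0) • c)
  | .h i, .e j => (2 : ℂ) • e (i + j)
  | .e j, .h i => -((2 : ℂ) • e (i + j))
  | .h i, .f j => -((2 : ℂ) • f (i + j))
  | .f j, .h i => (2 : ℂ) • f (i + j)
  | .h i, .h j => (if i + j = 0 then 2 * (i : ℂ) else 0) • c
  | .d i, .d j => ((j : ℂ) - i) • d (i + j) +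
      (if i + j = 0 then ((i : ℂ) ^ 3 - i) / 12 else 0) • c
  | .d i, .e j => (j : ℂ) • e (i + j)
  | .e j, .d i => -((j : ℂ) • e (i + j))
  | .d i, .f j => (j : ℂ) • f (i + j)
  | .f j, .d i => -((j : ℂ) • f (i + j))
  | .d i, .h j => (j : ℂ) • h (i + j)
  | .h j, .d i => -((j : ℂ) • h (i + j))
  | .C, _ => 0
  | _, .C => 0

/-- The bilinear extension of `table`. -/
def bracketLin : AffVir →ₗ[ℂ] AffVir →ₗ[ℂ] AffVir :=
  basis.constr ℂ fun x => basis.constr ℂ fun y => table x y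

theorem bracketLin_basis (x y : Gen) : bracketLin (basis x) (basis y) = table x y := by
  simp [bracketLin, Module.Basis.constr_basis]

theorem table_skew (x y : Gen) : table x y = -table y x := by
  rcases x with i | i | i | i | _ <;> rcases y with j | j | j | j | _ <;>
    try simp only [table, neg_neg, neg_zero]
  all_goals try rw [add_comm j i]
  · rw [← neg_smul]
    split_ifs with H
    · obtain rfl : j = -i := by omega
      simp
    · simp
  · rw [neg_add, ← neg_smul, ← neg_smul]
    congr 2
    · ring
    · split_ifs with H
      · obtain rfl : j = -i := by omega
        push_cast
        ring
      · simp

theorem bracketLin_skew (x y : AffVir) : bracketLin x y = -bracketLin y x := by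
  have H : bracketLin = -bracketLin.flip := by
    refine basis.ext fun a => basis.ext fun b => ?_
    simp only [LinearMap.neg_apply, LinearMap.flip_apply, bracketLin_basis]
    exact table_skew a b
  simpa using LinearMap.congr_fun (LinearMap.congr_fun H x) y

theorem table_jacobi (x y z : Gen) :
    bracketLin (basis x) (table y z) =
      bracketLin (table x y) (basis z) + bracketLin (basis y) (table x z) := by
  rcases x with i | i | i | i | _ <;> rcases y with j | j | j | j | _ <;>
    rcases z with k | k | k | k | _ <;>
    simp only [table, e, f, h, d, c, map_add, map_neg, map_smul, map_zero, bracketLin_basis,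
      LinearMap.add_apply, LinearMap.neg_apply, LinearMap.smul_apply, LinearMap.zero_apply,
      smul_zero, add_zero, zero_add, neg_zero, add_comm, add_left_comm] <;>
    (by_cases H : i + (j + k) = 0
     · have Hk : (k : ℂ) = -i - j := by
         have H2 : ((i + (j + k) : ℤ) : ℂ) = 0 := by rw [H]; simp
         push_cast at H2
         linear_combination H2
       try simp only [H, if_true]
       match_scalars <;> (try simp only [Hk]) <;> ring
     · try simp only [H, if_false]
       module)

theorem gen_induction {p : AffVir → Prop} (hb : ∀ g, p (basis g))
    (ha : ∀ x y, p x → p y → p (x + y)) (hs : ∀ (r : ℂ) x, p x → p (r • x)) (x : AffVir) : p x := by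
  have hx : x ∈ Submodule.span ℂ (Set.range basis) := by simp [basis.span_eq]
  induction hx using Submodule.span_induction with
  | mem x hx => obtain ⟨g, rfl⟩ := hx; exact hb g
  | zero => simpa using hs 0 _ (hb Gen.C)
  | add x y _ _ h1 h2 => exact ha x y h1 h2
  | smul r x _ h1 => exact hs r x h1

theorem bracketLin_jacobi (x y z : AffVir) :
    bracketLin x (bracketLin y z) =
      bracketLin (bracketLin x y) z + bracketLin y (bracketLin x z) := by
  induction x using gen_induction with
  | ha x x' h1 h2 => simp only [map_add, LinearMap.add_apply, h1, h2]; abel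
  | hs r x h1 => simp only [map_smul, LinearMap.smul_apply, h1, smul_add]
  | hb x =>
  induction y using gen_induction with
  | ha y y' h1 h2 => simp only [map_add, LinearMap.add_apply, h1, h2]; abel
  | hs r y h1 => simp only [map_smul, LinearMap.smul_apply, h1, smul_add]
  | hb y =>
  induction z using gen_induction with
  | ha z z' h1 h2 => simp only [map_add, h1, h2]; abel
  | hs r z h1 => simp only [map_smul, h1, smul_add]
  | hb z => simpa only [bracketLin_basis] using table_jacobi x y z

instance : Bracket AffVir AffVir where
  bracket x y := bracketLin x y

theorem lie_def (x y : AffVir) : ⁅x, y⁆ = bracketLin x y := rfl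

instance : LieRing AffVir where
  add_lie x y z := by simp [lie_def]
  lie_add x y z := by simp [lie_def]
  lie_self x := by
    have H : (2 : ℂ) • bracketLin x x = 0 := by
      rw [two_smul]
      nth_rewrite 1 [bracketLin_skew x x]
      exact neg_add_cancel _
    simpa [lie_def] using H
  leibniz_lie := bracketLin_jacobi

instance : LieAlgebra ℂ AffVir where
  lie_smul r x y := by simp [lie_def]

theorem lie_basis (x y : Gen) : ⁅basis x, basis y⁆ = table x y := bracketLin_basis x y

theorem lie_e_f (i j : ℤ) :
    ⁅e i, f j⁆ = h (i + j) + (if i + j = 0 then (i : ℂ) else 0) • c := lie_basis _ _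

theorem lie_h_e (i j : ℤ) : ⁅h i, e j⁆ = (2 : ℂ) • e (i + j) := lie_basis _ _

theorem lie_h_f (i j : ℤ) : ⁅h i, f j⁆ = -((2 : ℂ) • f (i + j)) := lie_basis _ _

theorem lie_d_d (i j : ℤ) :
    ⁅d i, d j⁆ = ((j : ℂ) - i) • d (i + j) +
      (if i + j = 0 then ((i : ℂ) ^ 3 - i) / 12 else 0) • c := lie_basis _ _

theorem lie_d_h (i j : ℤ) : ⁅d i, h j⁆ = (j : ℂ) • h (i + j) := lie_basis _ _

theorem lie_h_h (i j : ℤ) : ⁅h i, h j⁆ = (if i + j = 0 then 2 * (i : ℂ) else 0) • c :=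
  lie_basis _ _

theorem lie_d_e (i j : ℤ) : ⁅d i, e j⁆ = (j : ℂ) • e (i + j) := lie_basis _ _

theorem lie_d_f (i j : ℤ) : ⁅d i, f j⁆ = (j : ℂ) • f (i + j) := lie_basis _ _

theorem lie_e_e (i j : ℤ) : ⁅e i, e j⁆ = 0 := lie_basis _ _

theorem lie_f_f (i j : ℤ) : ⁅f i, f j⁆ = 0 := lie_basis _ _

theorem c_lie (x : AffVir) : ⁅c, x⁆ = 0 := by
  induction x using gen_induction with
  | ha x y h1 h2 => rw [lie_add, h1, h2, add_zero]
  | hs r x h1 => rw [lie_smul, h1, smul_zero]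
  | hb x => exact (lie_basis _ _).trans (by cases x <;> rfl)

/-! ### Modules over the enveloping algebra, induced modules -/

section Induced

attribute [local instance] LieRingModule.ofAssociativeModule

variable {L : Type*} [LieRing L] [LieAlgebra ℂ L] (K : LieSubalgebra ℂ L)
  {N : Type*} [AddCommGroup N] [Module ℂ N] (ρ : K →ₗ⁅ℂ⁆ Module.End ℂ N)

/-- The algebra homomorphism `U(K) → U(L)` induced by the inclusion `K ⊆ L`. -/
def envIncl : UniversalEnvelopingAlgebra ℂ K →ₐ[ℂ] UniversalEnvelopingAlgebra ℂ L :=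
  UniversalEnvelopingAlgebra.lift ℂ ((UniversalEnvelopingAlgebra.ι ℂ).comp K.incl)

/-- The action of `U(K)` on a `K`-module. -/
def envAct : UniversalEnvelopingAlgebra ℂ K →ₐ[ℂ] Module.End ℂ N :=
  UniversalEnvelopingAlgebra.lift ℂ ρ

/-- The `U(L)`-submodule of `U(L) ⊗_ℂ N` generated by the relations `u x ⊗ n = u ⊗ x n` for
`u ∈ U(L)`, `x ∈ U(K)` and `n ∈ N`. -/
def balancing : Submodule (UniversalEnvelopingAlgebra ℂ L)
    (UniversalEnvelopingAlgebra ℂ L ⊗[ℂ] N) :=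
  Submodule.span _ {z | ∃ (u : UniversalEnvelopingAlgebra ℂ L)
    (x : UniversalEnvelopingAlgebra ℂ K) (n : N),
    z = (u * envIncl K x) ⊗ₜ[ℂ] n - u ⊗ₜ[ℂ] (envAct K ρ x n)}

/-- The induced module `U(L) ⊗_{U(K)} N`, as the quotient of `U(L) ⊗_ℂ N` by the
balancing relations. -/
def Ind : Type _ := (UniversalEnvelopingAlgebra ℂ L ⊗[ℂ] N) ⧸ balancing K ρ

instance : AddCommGroup (Ind K ρ) :=
  inferInstanceAs (AddCommGroup ((UniversalEnvelopingAlgebra ℂ L ⊗[ℂ] N) ⧸ balancing K ρ))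

instance : Module (UniversalEnvelopingAlgebra ℂ L) (Ind K ρ) :=
  inferInstanceAs (Module (UniversalEnvelopingAlgebra ℂ L)
    ((UniversalEnvelopingAlgebra ℂ L ⊗[ℂ] N) ⧸ balancing K ρ))

instance : Module ℂ (Ind K ρ) :=
  inferInstanceAs (Module ℂ ((UniversalEnvelopingAlgebra ℂ L ⊗[ℂ] N) ⧸ balancing K ρ))

instance : IsScalarTower ℂ (UniversalEnvelopingAlgebra ℂ L) (Ind K ρ) :=
  inferInstanceAs (IsScalarTower ℂ (UniversalEnvelopingAlgebra ℂ L)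
    ((UniversalEnvelopingAlgebra ℂ L ⊗[ℂ] N) ⧸ balancing K ρ))

/-- `L` acts on the induced module by left multiplication. -/
instance : LieRingModule L (Ind K ρ) :=
  LieRingModule.compLieHom (Ind K ρ) (UniversalEnvelopingAlgebra.ι ℂ : L →ₗ⁅ℂ⁆ _)

instance : LieModule ℂ L (Ind K ρ) :=
  letI : LieModule ℂ (UniversalEnvelopingAlgebra ℂ L) (Ind K ρ) := LieModule.ofAssociativeModule
  LieModule.compLieHom (Ind K ρ) (UniversalEnvelopingAlgebra.ι ℂ : L →ₗ⁅ℂ⁆ _)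

/-- The class of `u ⊗ n` in the induced module. -/
def Ind.mk (u : UniversalEnvelopingAlgebra ℂ L) (n : N) : Ind K ρ :=
  Submodule.Quotient.mk (p := balancing K ρ) (u ⊗ₜ[ℂ] n)

theorem Ind.lie_mk (x : L) (u : UniversalEnvelopingAlgebra ℂ L) (n : N) :
    ⁅x, Ind.mk K ρ u n⁆ = Ind.mk K ρ (UniversalEnvelopingAlgebra.ι ℂ x * u) n := rfl

end Induced

/-! ### Verma modules -/

section Verma

attribute [local instance] LieRingModule.ofAssociativeModule

/-- The universal enveloping algebra of the affine-Virasoro algebra. -/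
abbrev UEnv : Type := UniversalEnvelopingAlgebra ℂ AffVir

/-- The canonical map from the affine-Virasoro algebra to its enveloping algebra. -/
abbrev toU : AffVir →ₗ⁅ℂ⁆ UEnv := UniversalEnvelopingAlgebra.ι ℂ

/-- The left ideal of the enveloping algebra generated by
`e_0, e_i, f_i, h_i, d_i` (`i ≥ 1`) and `d_0 - η, h_0 - ε, C - θ`. -/
def vermaIdeal (η ε θ : ℂ) : Submodule UEnv UEnv :=
  Submodule.span UEnv
    ({toU (e 0)} ∪ {x | ∃ i : ℤ, 1 ≤ i ∧
        (x = toU (e i) ∨ x = toU (f i) ∨ x = toU (h i) ∨ x = toU (d i))} ∪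
      {toU (d 0) - algebraMap ℂ UEnv η, toU (h 0) - algebraMap ℂ UEnv ε,
        toU c - algebraMap ℂ UEnv θ})

/-- The Verma module with highest weight `(η, ε, θ)`. -/
def Verma (η ε θ : ℂ) : Type := UEnv ⧸ vermaIdeal η ε θ

variable (η ε θ : ℂ)

instance : AddCommGroup (Verma η ε θ) := inferInstanceAs (AddCommGroup (UEnv ⧸ vermaIdeal η ε θ))

instance : Module UEnv (Verma η ε θ) := inferInstanceAs (Module UEnv (UEnv ⧸ vermaIdeal η ε θ))

instance : Module ℂ (Verma η ε θ) := inferInstanceAs (Module ℂ (UEnv ⧸ vermaIdeal η ε θ))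

instance : IsScalarTower ℂ UEnv (Verma η ε θ) :=
  inferInstanceAs (IsScalarTower ℂ UEnv (UEnv ⧸ vermaIdeal η ε θ))

instance : LieRingModule AffVir (Verma η ε θ) := LieRingModule.compLieHom (Verma η ε θ) toU

instance : LieModule ℂ AffVir (Verma η ε θ) :=
  letI : LieModule ℂ UEnv (Verma η ε θ) := LieModule.ofAssociativeModule
  LieModule.compLieHom (Verma η ε θ) toU

/-- The class of `u` in the Verma module; `Verma.mk η ε θ 1` is the highest weight vector. -/
def Verma.mk (u : UEnv) : Verma η ε θ := Submodule.Quotient.mk (p := vermaIdeal η ε θ) u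

theorem Verma.lie_mk (x : AffVir) (u : UEnv) :
    ⁅x, Verma.mk η ε θ u⁆ = Verma.mk η ε θ (toU x * u) := rfl

end Verma

/-! ### The modules on `ℂ[s, t]` -/

/-- The three families of modules. -/
inductive Family : Type
  | Omega
  | Delta
  | Theta

open Polynomial in
/-- The polynomial `E(t)` in the action `e_i g(s, t) = l ^ i E(t) g(s - i, t - 2)`. -/
def coeffE (M : Family) (a : ℂˣ) (b : ℂ) : ℂ[X] :=
  match M with
  | .Omega => C (a : ℂ)
  | .Delta => -C (1 / (a : ℂ)) * (C (1 / 2) * X + C b) * (C (1 / 2) * X - C b - 1)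
  | .Theta => C (a : ℂ) * (C (1 / 2) * X + C b)

open Polynomial in
/-- The polynomial `F(t)` in the action `f_i g(s, t) = l ^ i F(t) g(s - i, t + 2)`. -/
def coeffF (M : Family) (a : ℂˣ) (b : ℂ) : ℂ[X] :=
  match M with
  | .Omega => -C (1 / (a : ℂ)) * (C (1 / 2) * X - C b) * (C (1 / 2) * X + C b + 1)
  | .Delta => C (a : ℂ)
  | .Theta => -C (1 / (a : ℂ)) * (C (1 / 2) * X - C b)

open Polynomial in
/-- The substitution `g(t) ↦ g(t - j)`. -/
def shiftT (j : ℂ) : ℂ[X] →ₐ[ℂ] ℂ[X] := aeval (X - C j)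

open Polynomial in
theorem shiftT_shiftT (i j : ℂ) (p : ℂ[X]) : shiftT i (shiftT j p) = shiftT (i + j) p := by
  have H : (shiftT i).comp (shiftT j) = shiftT (i + j) := by
    ext
    simp [shiftT]
    ring
  exact DFunLike.congr_fun H p

theorem shiftT_zero (p : Polynomial ℂ) : shiftT 0 p = p := by
  simp [shiftT]

open Polynomial in
theorem coeff_identity (M : Family) (a : ℂˣ) (b : ℂ) :
    coeffE M a b * shiftT 2 (coeffF M a b) - coeffF M a b * shiftT (-2) (coeffE M a b) = X := by
  have ha : (a : ℂ) ≠ 0 := a.ne_zero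
  refine Polynomial.funext fun z => ?_
  cases M <;> simp [coeffE, coeffF, shiftT] <;> field_simp <;> ring

/-- The substitution `g(s, t) ↦ g(s - i, t - j)`; the variable `s` is `X 0` and `t` is `X 1`. -/
def shiftST (i j : ℂ) : MvPolynomial (Fin 2) ℂ →ₐ[ℂ] MvPolynomial (Fin 2) ℂ :=
  MvPolynomial.aeval ![MvPolynomial.X 0 - MvPolynomial.C i, MvPolynomial.X 1 - MvPolynomial.C j]

/-- A polynomial in `t`, seen as a polynomial in `s` and `t`. -/
def inT : Polynomial ℂ →ₐ[ℂ] MvPolynomial (Fin 2) ℂ :=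
  Polynomial.aeval (MvPolynomial.X 1)

theorem shiftST_shiftST (i j i' j' : ℂ) (p : MvPolynomial (Fin 2) ℂ) :
    shiftST i j (shiftST i' j' p) = shiftST (i + i') (j + j') p := by
  have H : (shiftST i j).comp (shiftST i' j') = shiftST (i + i') (j + j') := by
    refine MvPolynomial.algHom_ext fun k => ?_
    fin_cases k <;> simp [shiftST, MvPolynomial.algebraMap_eq] <;> ring
  exact DFunLike.congr_fun H p

theorem shiftST_inT (i j : ℂ) (p : Polynomial ℂ) : shiftST i j (inT p) = inT (shiftT j p) := by
  have H : (shiftST i j).comp inT = inT.comp (shiftT j) := by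
    ext
    simp [shiftST, shiftT, inT, MvPolynomial.algebraMap_eq]
  exact DFunLike.congr_fun H p

theorem shiftST_s (i j : ℂ) :
    shiftST i j (MvPolynomial.X 0) = MvPolynomial.X 0 - MvPolynomial.C i := by
  simp [shiftST]

theorem shiftST_t (i j : ℂ) :
    shiftST i j (MvPolynomial.X 1) = MvPolynomial.X 1 - MvPolynomial.C j := by
  simp [shiftST]

/-- The operators of the basis elements on `ℂ[s, t]`. -/
def polyOp (M : Family) (l a : ℂˣ) (b g : ℂ) : Gen → Module.End ℂ (MvPolynomial (Fin 2) ℂ)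
  | .e i => (l : ℂ) ^ i • (LinearMap.mulLeft ℂ (inT (coeffE M a b)) ∘ₗ (shiftST i 2).toLinearMap)
  | .f i => (l : ℂ) ^ i •
      (LinearMap.mulLeft ℂ (inT (coeffF M a b)) ∘ₗ (shiftST i (-2)).toLinearMap)
  | .h i => (l : ℂ) ^ i •
      (LinearMap.mulLeft ℂ (MvPolynomial.X 1) ∘ₗ (shiftST i 0).toLinearMap)
  | .d i => (l : ℂ) ^ i •
      (LinearMap.mulLeft ℂ (MvPolynomial.X 0 + MvPolynomial.C (i * g)) ∘ₗ
        (shiftST i 0).toLinearMap)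
  | .C => 0

theorem inT_identity (M : Family) (a : ℂˣ) (b : ℂ) :
    inT (coeffE M a b) * inT (shiftT 2 (coeffF M a b)) -
      inT (coeffF M a b) * inT (shiftT (-2) (coeffE M a b)) = MvPolynomial.X 1 := by
  rw [← map_mul, ← map_mul, ← map_sub, coeff_identity]
  simp [inT]

theorem polyOp_lie (M : Family) (l a : ℂˣ) (b g : ℂ) (x y : Gen) :
    basis.constr ℂ (polyOp M l a b g) (table x y) =
      polyOp M l a b g x * polyOp M l a b g y - polyOp M l a b g y * polyOp M l a b g x := by
  have hl : (l : ℂ) ≠ 0 := l.ne_zero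
  have hid := inT_identity M a b
  have hC : ∀ (r : ℂ) (p : MvPolynomial (Fin 2) ℂ), r • p = MvPolynomial.C r * p :=
    fun r p => MvPolynomial.smul_eq_C_mul p r
  rcases x with i | i | i | i | _ <;> rcases y with j | j | j | j | _ <;>
    refine LinearMap.ext fun p => ?_ <;>
    simp only [table, e, f, h, d, c, map_add, map_neg, map_smul, map_zero,
      Module.Basis.constr_basis, polyOp, LinearMap.neg_apply,
      LinearMap.sub_apply, LinearMap.smul_apply, LinearMap.zero_apply, Module.End.mul_apply,
      LinearMap.comp_apply, LinearMap.mulLeft_apply, AlgHom.toLinearMap_apply, map_mul,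
      shiftST_shiftST, shiftST_inT, shiftST_s, shiftST_t, smul_zero, mul_zero, zero_mul,
      sub_zero, add_zero, zero_add, hC, MvPolynomial.algHom_C,
      MvPolynomial.algebraMap_eq, zpow_add₀ hl, Int.cast_add, shiftT_zero,
      add_neg_cancel, neg_add_cancel, map_add, map_sub, map_neg, map_ofNat, map_intCast] <;>
    (try simp only [add_comm (j : ℂ) (i : ℂ)]) <;>
    first
      | ring1
      | linear_combination (MvPolynomial.C ((l : ℂ) ^ i) * MvPolynomial.C ((l : ℂ) ^ j) *
          shiftST (i + j) 0 p) * hid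
      | linear_combination -(MvPolynomial.C ((l : ℂ) ^ i) * MvPolynomial.C ((l : ℂ) ^ j) *
          shiftST (i + j) 0 p) * hid

/-- The representation with prescribed operators of the standard basis elements, when these respect
the brackets. -/
def liftGen {W : Type*} [AddCommGroup W] [Module ℂ W] (T : Gen → Module.End ℂ W)
    (hT : ∀ x y, basis.constr ℂ T (table x y) = T x * T y - T y * T x) :
    AffVir →ₗ⁅ℂ⁆ Module.End ℂ W :=
  { basis.constr ℂ T with
    map_lie' := by
      intro x y
      change basis.constr ℂ T ⁅x, y⁆ = ⁅basis.constr ℂ T x, basis.constr ℂ T y⁆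
      induction x using gen_induction with
      | ha x x' h1 h2 => simp only [map_add, add_lie, h1, h2]
      | hs r x h1 => simp only [map_smul, smul_lie, h1]
      | hb x =>
      induction y using gen_induction with
      | ha y y' h1 h2 => simp only [map_add, lie_add, h1, h2]
      | hs r y h1 => simp only [map_smul, lie_smul, h1]
      | hb y => rw [lie_basis, hT, Module.Basis.constr_basis, Module.Basis.constr_basis,
          LieRing.of_associative_ring_bracket] }

/-- The module `Ω(l, a, b, g)`, `Δ(l, a, b, g)` or `Θ(l, a, b, g)`; its space is `ℂ[s, t]`. -/
def PolyMod (_M : Family) (_l _a : ℂˣ) (_b _g : ℂ) : Type := MvPolynomial (Fin 2) ℂ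

section PolyMod

variable (M : Family) (l a : ℂˣ) (b g : ℂ)

instance : AddCommGroup (PolyMod M l a b g) :=
  inferInstanceAs (AddCommGroup (MvPolynomial (Fin 2) ℂ))

instance : Module ℂ (PolyMod M l a b g) :=
  inferInstanceAs (Module ℂ (MvPolynomial (Fin 2) ℂ))

/-- The representation on `PolyMod`. -/
def polyRep : AffVir →ₗ⁅ℂ⁆ Module.End ℂ (PolyMod M l a b g) :=
  liftGen (W := PolyMod M l a b g) (polyOp M l a b g) (polyOp_lie M l a b g)

instance : LieRingModule AffVir (PolyMod M l a b g) :=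
  LieRingModule.compLieHom (PolyMod M l a b g) (polyRep M l a b g)

instance : LieModule ℂ AffVir (PolyMod M l a b g) :=
  LieModule.compLieHom (PolyMod M l a b g) (polyRep M l a b g)

/-- A polynomial as an element of the module. -/
def PolyMod.mk (p : MvPolynomial (Fin 2) ℂ) : PolyMod M l a b g := p

theorem basis_lie_mk (x : Gen) (p : MvPolynomial (Fin 2) ℂ) :
    ⁅basis x, PolyMod.mk M l a b g p⁆ = PolyMod.mk M l a b g (polyOp M l a b g x p) := by
  change basis.constr ℂ (polyOp M l a b g) (basis x) p = _
  rw [Module.Basis.constr_basis]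
  rfl

theorem e_lie_mk (i : ℤ) (p : MvPolynomial (Fin 2) ℂ) :
    ⁅e i, PolyMod.mk M l a b g p⁆ =
      PolyMod.mk M l a b g ((l : ℂ) ^ i • (inT (coeffE M a b) * shiftST i 2 p)) :=
  basis_lie_mk M l a b g _ p

theorem f_lie_mk (i : ℤ) (p : MvPolynomial (Fin 2) ℂ) :
    ⁅f i, PolyMod.mk M l a b g p⁆ =
      PolyMod.mk M l a b g ((l : ℂ) ^ i • (inT (coeffF M a b) * shiftST i (-2) p)) :=
  basis_lie_mk M l a b g _ p

theorem h_lie_mk (i : ℤ) (p : MvPolynomial (Fin 2) ℂ) :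
    ⁅h i, PolyMod.mk M l a b g p⁆ =
      PolyMod.mk M l a b g ((l : ℂ) ^ i • (MvPolynomial.X 1 * shiftST i 0 p)) :=
  basis_lie_mk M l a b g _ p

theorem d_lie_mk (i : ℤ) (p : MvPolynomial (Fin 2) ℂ) :
    ⁅d i, PolyMod.mk M l a b g p⁆ =
      PolyMod.mk M l a b g ((l : ℂ) ^ i •
        ((MvPolynomial.X 0 + MvPolynomial.C (i * g)) * shiftST i 0 p)) :=
  basis_lie_mk M l a b g _ p

theorem c_lie_mk (p : MvPolynomial (Fin 2) ℂ) : ⁅c, PolyMod.mk M l a b g p⁆ = 0 :=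
  basis_lie_mk M l a b g _ p

end PolyMod

/-! ### The subalgebra and its modules on `ℂ[t]` -/

/-- The spanning elements `d_m - l ^ m d_0`, `f_m` (`m ≥ 1`), `h_n`, `e_n` (`n ≥ 0`) and `C`. -/
inductive IsSubGen (l : ℂˣ) : AffVir → Prop
  | d (m : ℕ) (hm : 1 ≤ m) : IsSubGen l (d m - (l : ℂ) ^ m • d 0)
  | f (m : ℕ) (hm : 1 ≤ m) : IsSubGen l (f m)
  | h (n : ℕ) : IsSubGen l (h n)
  | e (n : ℕ) : IsSubGen l (e n)
  | c : IsSubGen l c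

theorem lie_gen_mem (l : ℂˣ) {x y : AffVir} (hx : IsSubGen l x) (hy : IsSubGen l y) :
    ⁅x, y⁆ ∈ Submodule.span ℂ {z | IsSubGen l z} := by
  have hl : (l : ℂ) ≠ 0 := l.ne_zero
  set S := Submodule.span ℂ {z | IsSubGen l z} with hS
  have mf (i : ℤ) (hi : 1 ≤ i) : f i ∈ S := by
    lift i to ℕ using by omega
    exact Submodule.subset_span (.f i (by omega))
  have mh (i : ℤ) (hi : 0 ≤ i) : h i ∈ S := by
    lift i to ℕ using by omega
    exact Submodule.subset_span (.h i)
  have me (i : ℤ) (hi : 0 ≤ i) : e i ∈ S := by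
    lift i to ℕ using by omega
    exact Submodule.subset_span (.e i)
  have md (i : ℤ) (hi : 1 ≤ i) : d i - (l : ℂ) ^ i • d 0 ∈ S := by
    lift i to ℕ using by omega
    rw [zpow_natCast]
    exact Submodule.subset_span (IsSubGen.d i (by omega))
  have mc : c ∈ S := Submodule.subset_span .c
  have sw (x y : AffVir) (hxy : ⁅x, y⁆ ∈ S) : ⁅y, x⁆ ∈ S := by
    rw [← lie_skew]
    exact S.neg_mem hxy
  have hc (x : AffVir) : ⁅c, x⁆ ∈ S := by
    rw [c_lie]
    exact S.zero_mem
  have hcc (x : AffVir) : ⁅x, c⁆ ∈ S := sw _ _ (hc x)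
  have hdf (m k : ℕ) (hk : 1 ≤ k) : ⁅d m - (l : ℂ) ^ m • d 0, f k⁆ ∈ S := by
    rw [sub_lie, smul_lie, lie_d_f, lie_d_f]
    exact S.sub_mem (S.smul_mem _ (mf _ (by omega)))
      (S.smul_mem _ (S.smul_mem _ (mf _ (by omega))))
  have hdh (m k : ℕ) : ⁅d m - (l : ℂ) ^ m • d 0, h k⁆ ∈ S := by
    rw [sub_lie, smul_lie, lie_d_h, lie_d_h]
    exact S.sub_mem (S.smul_mem _ (mh _ (by omega)))
      (S.smul_mem _ (S.smul_mem _ (mh _ (by omega))))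
  have hde (m k : ℕ) : ⁅d m - (l : ℂ) ^ m • d 0, e k⁆ ∈ S := by
    rw [sub_lie, smul_lie, lie_d_e, lie_d_e]
    exact S.sub_mem (S.smul_mem _ (me _ (by omega)))
      (S.smul_mem _ (S.smul_mem _ (me _ (by omega))))
  have hef (n m : ℕ) (hm : 1 ≤ m) : ⁅e n, f m⁆ ∈ S := by
    rw [lie_e_f]
    exact S.add_mem (mh _ (by omega)) (S.smul_mem _ mc)
  have hhf (n m : ℕ) (hm : 1 ≤ m) : ⁅h n, f m⁆ ∈ S := by
    rw [lie_h_f]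
    exact S.neg_mem (S.smul_mem _ (mf _ (by omega)))
  have hhe (n m : ℕ) : ⁅h n, e m⁆ ∈ S := by
    rw [lie_h_e]
    exact S.smul_mem _ (me _ (by omega))
  have hdd (m k : ℕ) (hm : 1 ≤ m) (hk : 1 ≤ k) :
      ⁅d m - (l : ℂ) ^ m • d 0, d k - (l : ℂ) ^ k • d 0⁆ ∈ S := by
    have key : ⁅d m - (l : ℂ) ^ m • d 0, d k - (l : ℂ) ^ k • d 0⁆ =
        ((k : ℂ) - m) • (d ((m : ℤ) + k) - (l : ℂ) ^ ((m : ℤ) + k) • d 0) +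
          ((m : ℂ) * (l : ℂ) ^ k) • (d m - (l : ℂ) ^ (m : ℤ) • d 0) -
          ((k : ℂ) * (l : ℂ) ^ m) • (d k - (l : ℂ) ^ (k : ℤ) • d 0) := by
      have h1 : ((m : ℤ) + k = 0) = False := by simp; omega
      have h2 : ((m : ℤ) = 0) = False := by simp; omega
      have h3 : ((k : ℤ) = 0) = False := by simp; omega
      simp only [sub_lie, lie_sub, smul_lie, lie_smul, lie_d_d, h1, h2, h3, if_false, add_zero,
        zero_add, zero_smul, zpow_add₀ hl, zpow_natCast, lie_self]
      push_cast
      module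
    rw [key]
    exact S.sub_mem (S.add_mem (S.smul_mem _ (md _ (by omega))) (S.smul_mem _ (md _ (by omega))))
      (S.smul_mem _ (md _ (by omega)))
  cases hx with
  | c => exact hc _
  | d m hm =>
    cases hy with
    | c => exact hcc _
    | d k hk => exact hdd m k hm hk
    | f k hk => exact hdf m k hk
    | h k => exact hdh m k
    | e k => exact hde m k
  | f m hm =>
    cases hy with
    | c => exact hcc _
    | d k hk => exact sw _ _ (hdf k m hm)
    | f k hk => rw [lie_f_f]; exact S.zero_mem
    | h k => exact sw _ _ (hhf k m hm)
    | e k => exact sw _ _ (hef k m hm)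
  | h m =>
    cases hy with
    | c => exact hcc _
    | d k hk => exact sw _ _ (hdh k m)
    | f k hk => exact hhf m k hk
    | h k => rw [lie_h_h]; exact S.smul_mem _ mc
    | e k => exact hhe m k
  | e m =>
    cases hy with
    | c => exact hcc _
    | d k hk => exact sw _ _ (hde k m)
    | f k hk => exact hef m k hk
    | h k => exact sw _ _ (hhe k m)
    | e k => rw [lie_e_e]; exact S.zero_mem

/-- The subalgebra with underlying space
`span {d_m - l ^ m d_0, f_m, h_n, e_n, C | m ≥ 1, n ≥ 0}`. -/
def subB (l : ℂˣ) : LieSubalgebra ℂ AffVir :=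
  { Submodule.span ℂ {z | IsSubGen l z} with
    lie_mem' := by
      intro x y hx hy
      change x ∈ Submodule.span ℂ {z | IsSubGen l z} at hx
      change y ∈ Submodule.span ℂ {z | IsSubGen l z} at hy
      change ⁅x, y⁆ ∈ Submodule.span ℂ {z | IsSubGen l z}
      induction hx, hy using Submodule.span_induction₂ with
      | mem_mem x y hx hy => exact lie_gen_mem l hx hy
      | zero_left y hy => simp
      | zero_right x hx => simp
      | add_left x y z _ _ _ h1 h2 => rw [add_lie]; exact Submodule.add_mem _ h1 h2
      | add_right x y z _ _ _ h1 h2 => rw [lie_add]; exact Submodule.add_mem _ h1 h2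
      | smul_left r x y _ _ h1 => rw [smul_lie]; exact Submodule.smul_mem _ _ h1
      | smul_right r x y _ _ h1 => rw [lie_smul]; exact Submodule.smul_mem _ _ h1 }

section SubRep

variable (M : Family) (l a : ℂˣ) (b g η ε θ : ℂ)

/-- Operators on `ℂ[t]` labelled by the basis elements. Their linear extension to the whole
affine-Virasoro algebra is not a representation, but its restriction to `subB l` is, and takes
there the values computed in `subRep_d`, `subRep_f`, `subRep_h`, `subRep_e` and `subRep_c`. -/
def subOp : Gen → Module.End ℂ (Polynomial ℂ)
  | .e i => (l : ℂ) ^ i • (LinearMap.mulLeft ℂ (coeffE M a b) ∘ₗ (shiftT 2).toLinearMap)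
  | .f i => (l : ℂ) ^ i • (LinearMap.mulLeft ℂ (coeffF M a b) ∘ₗ (shiftT (-2)).toLinearMap)
  | .h i => (l : ℂ) ^ i •
      LinearMap.mulLeft ℂ (Polynomial.X + Polynomial.C (if i = 0 then ε else 0))
  | .d i => (if i = 0 then 0 else (l : ℂ) ^ i * (i * g - η)) • LinearMap.id
  | .C => θ • LinearMap.id

/-- The linear extension of `subOp`. -/
def subLin : AffVir →ₗ[ℂ] Module.End ℂ (Polynomial ℂ) := basis.constr ℂ (subOp M l a b g η ε θ)

theorem subLin_e (i : ℤ) : subLin M l a b g η ε θ (e i) = subOp M l a b g η ε θ (.e i) :=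
  Module.Basis.constr_basis ..

theorem subLin_f (i : ℤ) : subLin M l a b g η ε θ (f i) = subOp M l a b g η ε θ (.f i) :=
  Module.Basis.constr_basis ..

theorem subLin_h (i : ℤ) : subLin M l a b g η ε θ (h i) = subOp M l a b g η ε θ (.h i) :=
  Module.Basis.constr_basis ..

theorem subLin_d (i : ℤ) : subLin M l a b g η ε θ (d i) = subOp M l a b g η ε θ (.d i) :=
  Module.Basis.constr_basis ..

theorem subLin_c : subLin M l a b g η ε θ c = subOp M l a b g η ε θ .C :=
  Module.Basis.constr_basis ..

theorem subLin_dsub (m : ℕ) (hm : 1 ≤ m) :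
    subLin M l a b g η ε θ (d m - (l : ℂ) ^ m • d 0) =
      ((l : ℂ) ^ m * (m * g - η)) • LinearMap.id := by
  have h2 : ¬ m = 0 := by omega
  simp [subLin_d, subOp, h2]

theorem subLin_lie {x y : AffVir} (hx : IsSubGen l x) (hy : IsSubGen l y) :
    subLin M l a b g η ε θ ⁅x, y⁆ =
      subLin M l a b g η ε θ x * subLin M l a b g η ε θ y -
        subLin M l a b g η ε θ y * subLin M l a b g η ε θ x := by
  have hl : (l : ℂ) ≠ 0 := l.ne_zero
  set D := subLin M l a b g η ε θ with hD
  have hid := coeff_identity M a b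
  have hC : ∀ (r : ℂ) (p : Polynomial ℂ), r • p = Polynomial.C r * p :=
    fun r p => Polynomial.smul_eq_C_mul r
  have sw (x y : AffVir) (hxy : D ⁅x, y⁆ = D x * D y - D y * D x) :
      D ⁅y, x⁆ = D y * D x - D x * D y := by
    rw [← lie_skew, map_neg, hxy, neg_sub]
  have sx : ∀ j, shiftT j Polynomial.X = Polynomial.X - Polynomial.C j := by simp [shiftT]
  have sC : ∀ j r, shiftT j (Polynomial.C r) = Polynomial.C r := by simp [shiftT]
  have hc (x : AffVir) : D ⁅c, x⁆ = D c * D x - D x * D c := by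
    rw [c_lie, hD, subLin_c]
    simp only [subOp, map_zero]
    refine LinearMap.ext fun p => ?_
    simp
  have hcc (x : AffVir) : D ⁅x, c⁆ = D x * D c - D c * D x := sw _ _ (hc x)
  have hscal (m : ℕ) (hm : 1 ≤ m) (T : Module.End ℂ (Polynomial ℂ)) :
      D (d m - (l : ℂ) ^ m • d 0) * T - T * D (d m - (l : ℂ) ^ m • d 0) = 0 := by
    rw [hD, subLin_dsub M l a b g η ε θ m hm]
    refine LinearMap.ext fun p => ?_
    simp
  have hdf (m k : ℕ) (hm : 1 ≤ m) : D ⁅d m - (l : ℂ) ^ m • d 0, f k⁆ =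
      D (d m - (l : ℂ) ^ m • d 0) * D (f k) - D (f k) * D (d m - (l : ℂ) ^ m • d 0) := by
    rw [hscal m hm, sub_lie, smul_lie, lie_d_f, lie_d_f]
    simp only [hD, map_sub, map_smul, subLin_f, subOp, zero_add, zpow_add₀ hl, zpow_natCast]
    module
  have hde (m k : ℕ) (hm : 1 ≤ m) : D ⁅d m - (l : ℂ) ^ m • d 0, e k⁆ =
      D (d m - (l : ℂ) ^ m • d 0) * D (e k) - D (e k) * D (d m - (l : ℂ) ^ m • d 0) := by
    rw [hscal m hm, sub_lie, smul_lie, lie_d_e, lie_d_e]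
    simp only [hD, map_sub, map_smul, subLin_e, subOp, zero_add, zpow_add₀ hl, zpow_natCast]
    module
  have hdh (m k : ℕ) (hm : 1 ≤ m) : D ⁅d m - (l : ℂ) ^ m • d 0, h k⁆ =
      D (d m - (l : ℂ) ^ m • d 0) * D (h k) - D (h k) * D (d m - (l : ℂ) ^ m • d 0) := by
    rw [hscal m hm, sub_lie, smul_lie, lie_d_h, lie_d_h]
    rcases Nat.eq_zero_or_pos k with rfl | hk
    · simp
    · have h1 : ((m : ℤ) + k = 0) = False := by simp; omega
      have h2 : ((k : ℤ) = 0) = False := by simp; omega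
      simp only [hD, map_sub, map_smul, subLin_h, subOp, zero_add, zpow_add₀ hl, zpow_natCast,
        h1, h2, if_false]
      module
  have hef (n m : ℕ) (hm : 1 ≤ m) : D ⁅e n, f m⁆ = D (e n) * D (f m) - D (f m) * D (e n) := by
    have h1 : ((n : ℤ) + m = 0) = False := by simp; omega
    rw [lie_e_f]
    refine LinearMap.ext fun p => ?_
    simp only [hD, subLin_h, subLin_e, subLin_f, subOp, h1, if_false, zero_smul, add_zero, map_zero,
      LinearMap.sub_apply, LinearMap.smul_apply, Module.End.mul_apply,
      LinearMap.comp_apply, LinearMap.mulLeft_apply, AlgHom.toLinearMap_apply, map_mul,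
      shiftT_shiftT, add_neg_cancel, neg_add_cancel, shiftT_zero, hC, sC, zpow_add₀ hl]
    linear_combination -(Polynomial.C ((l : ℂ) ^ (n : ℤ)) * Polynomial.C ((l : ℂ) ^ (m : ℤ)) *
      p) * hid
  have hhf (n m : ℕ) (hm : 1 ≤ m) : D ⁅h n, f m⁆ = D (h n) * D (f m) - D (f m) * D (h n) := by
    rw [lie_h_f]
    refine LinearMap.ext fun p => ?_
    simp only [hD, map_neg, map_smul, subLin_h, subLin_f, subOp,
      LinearMap.sub_apply, LinearMap.smul_apply, Module.End.mul_apply, LinearMap.neg_apply,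
      LinearMap.comp_apply, LinearMap.mulLeft_apply, AlgHom.toLinearMap_apply, map_mul, map_smul,
      map_add, map_neg, sx, sC, hC, zpow_add₀ hl, map_ofNat]
    ring
  have hhe (n m : ℕ) : D ⁅h n, e m⁆ = D (h n) * D (e m) - D (e m) * D (h n) := by
    rw [lie_h_e]
    refine LinearMap.ext fun p => ?_
    simp only [hD, map_smul, subLin_h, subLin_e, subOp,
      LinearMap.sub_apply, LinearMap.smul_apply, Module.End.mul_apply,
      LinearMap.comp_apply, LinearMap.mulLeft_apply, AlgHom.toLinearMap_apply, map_mul, map_smul,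
      map_add, sx, sC, hC, zpow_add₀ hl, map_ofNat]
    ring
  have hhh (n m : ℕ) : D ⁅h n, h m⁆ = D (h n) * D (h m) - D (h m) * D (h n) := by
    have h0 : (if (n : ℤ) + m = 0 then 2 * ((n : ℤ) : ℂ) else 0) = 0 := by
      split_ifs with H
      · have : n = 0 := by omega
        simp [this]
      · rfl
    rw [lie_h_h, h0, zero_smul, map_zero]
    refine LinearMap.ext fun p => ?_
    simp only [hD, subLin_h, subOp, LinearMap.sub_apply, LinearMap.smul_apply,
      Module.End.mul_apply, LinearMap.mulLeft_apply, hC, LinearMap.zero_apply]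
    ring
  have hee (n m : ℕ) : D ⁅e n, e m⁆ = D (e n) * D (e m) - D (e m) * D (e n) := by
    rw [lie_e_e, map_zero]
    refine LinearMap.ext fun p => ?_
    simp only [hD, subLin_e, subOp, LinearMap.sub_apply, LinearMap.smul_apply,
      Module.End.mul_apply, LinearMap.mulLeft_apply, hC, LinearMap.zero_apply, map_mul, sC,
      LinearMap.comp_apply, AlgHom.toLinearMap_apply]
    ring
  have hff (n m : ℕ) : D ⁅f n, f m⁆ = D (f n) * D (f m) - D (f m) * D (f n) := by
    rw [lie_f_f, map_zero]
    refine LinearMap.ext fun p => ?_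
    simp only [hD, subLin_f, subOp, LinearMap.sub_apply, LinearMap.smul_apply,
      Module.End.mul_apply, LinearMap.mulLeft_apply, hC, LinearMap.zero_apply, map_mul, sC,
      LinearMap.comp_apply, AlgHom.toLinearMap_apply]
    ring
  have hdd (m k : ℕ) (hm : 1 ≤ m) (hk : 1 ≤ k) :
      D ⁅d m - (l : ℂ) ^ m • d 0, d k - (l : ℂ) ^ k • d 0⁆ =
        D (d m - (l : ℂ) ^ m • d 0) * D (d k - (l : ℂ) ^ k • d 0) -
          D (d k - (l : ℂ) ^ k • d 0) * D (d m - (l : ℂ) ^ m • d 0) := by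
    have h1 : ((m : ℤ) + k = 0) = False := by simp; omega
    have h2 : ((m : ℤ) = 0) = False := by simp; omega
    have h3 : ((k : ℤ) = 0) = False := by simp; omega
    rw [hscal m hm]
    simp only [sub_lie, lie_sub, smul_lie, lie_smul, lie_d_d, h1, h2, h3, if_false, add_zero,
      zero_add, zero_smul, zpow_add₀ hl, zpow_natCast, lie_self, map_sub, map_smul, hD,
      subLin_d, subOp, smul_zero, sub_zero]
    match_scalars
    push_cast
    ring
  cases hx with
  | c => exact hc _
  | d m hm =>
    cases hy with
    | c => exact hcc _
    | d k hk => exact hdd m k hm hk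
    | f k hk => exact hdf m k hm
    | h k => exact hdh m k hm
    | e k => exact hde m k hm
  | f m hm =>
    cases hy with
    | c => exact hcc _
    | d k hk => exact sw _ _ (hdf k m hk)
    | f k hk => exact hff m k
    | h k => exact sw _ _ (hhf k m hm)
    | e k => exact sw _ _ (hef k m hm)
  | h m =>
    cases hy with
    | c => exact hcc _
    | d k hk => exact sw _ _ (hdh k m hk)
    | f k hk => exact hhf m k hk
    | h k => exact hhh m k
    | e k => exact hhe m k
  | e m =>
    cases hy with
    | c => exact hcc _
    | d k hk => exact sw _ _ (hde k m hk)
    | f k hk => exact hef m k hk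
    | h k => exact sw _ _ (hhe k m)
    | e k => exact hee m k

/-- The action of `subB l` on `ℂ[t]`. -/
def subRep : subB l →ₗ⁅ℂ⁆ Module.End ℂ (Polynomial ℂ) :=
  { subLin M l a b g η ε θ ∘ₗ (subB l).toSubmodule.subtype with
    map_lie' := by
      rintro ⟨x, hx⟩ ⟨y, hy⟩
      change subLin M l a b g η ε θ ⁅x, y⁆ =
        subLin M l a b g η ε θ x * subLin M l a b g η ε θ y -
          subLin M l a b g η ε θ y * subLin M l a b g η ε θ x
      change x ∈ Submodule.span ℂ {z | IsSubGen l z} at hx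
      change y ∈ Submodule.span ℂ {z | IsSubGen l z} at hy
      induction hx, hy using Submodule.span_induction₂ with
      | mem_mem x y hx hy => exact subLin_lie M l a b g η ε θ hx hy
      | zero_left y hy => simp
      | zero_right x hx => simp
      | add_left x y z _ _ _ h1 h2 => simp only [add_lie, map_add, h1, h2, add_mul, mul_add]; abel
      | add_right x y z _ _ _ h1 h2 => simp only [lie_add, map_add, h1, h2, add_mul, mul_add]; abel
      | smul_left r x y _ _ h1 =>
        simp only [smul_lie, map_smul, h1, smul_mul_assoc, mul_smul_comm, smul_sub]
      | smul_right r x y _ _ h1 =>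
        simp only [lie_smul, map_smul, h1, smul_mul_assoc, mul_smul_comm, smul_sub] }

theorem subRep_d (m : ℕ) (hm : 1 ≤ m) (p : Polynomial ℂ) :
    subRep M l a b g η ε θ ⟨d m - (l : ℂ) ^ m • d 0, Submodule.subset_span (.d m hm)⟩ p =
      ((l : ℂ) ^ m * (m * g - η)) • p :=
  LinearMap.congr_fun (subLin_dsub M l a b g η ε θ m hm) p

theorem subRep_f (m : ℕ) (hm : 1 ≤ m) (p : Polynomial ℂ) :
    subRep M l a b g η ε θ ⟨f m, Submodule.subset_span (.f m hm)⟩ p =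
      (l : ℂ) ^ m • (coeffF M a b * shiftT (-2) p) := by
  rw [← zpow_natCast]
  exact LinearMap.congr_fun (subLin_f M l a b g η ε θ m) p

theorem subRep_h (n : ℕ) (p : Polynomial ℂ) :
    subRep M l a b g η ε θ ⟨h n, Submodule.subset_span (.h n)⟩ p =
      (l : ℂ) ^ n • ((Polynomial.X + Polynomial.C (if n = 0 then ε else 0)) * p) := by
  have H := LinearMap.congr_fun (subLin_h M l a b g η ε θ n) p
  simp only [subOp, zpow_natCast, Int.natCast_eq_zero] at H
  exact H

theorem subRep_e (n : ℕ) (p : Polynomial ℂ) :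
    subRep M l a b g η ε θ ⟨e n, Submodule.subset_span (.e n)⟩ p =
      (l : ℂ) ^ n • (coeffE M a b * shiftT 2 p) := by
  rw [← zpow_natCast]
  exact LinearMap.congr_fun (subLin_e M l a b g η ε θ n) p

theorem subRep_c (p : Polynomial ℂ) :
    subRep M l a b g η ε θ ⟨c, Submodule.subset_span .c⟩ p = θ • p :=
  LinearMap.congr_fun (subLin_c M l a b g η ε θ) p

/-- The induced module `U(𝔏) ⊗_{U(𝔟)} ℂ[t]`, for the subalgebra `𝔟 = subB l` acting on `ℂ[t]` by
`subRep`. -/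
abbrev IndMod : Type := Ind (subB l) (subRep M l a b g η ε θ)

end SubRep

end AffineVirasoro

end

/-! Both sides represent explicit functors, so no PBW basis is needed. Let v be the highest weight
vector, ψ the embedding of ℂ[s,t] to be built, and P any 𝔏-module.

A homomorphism Q ⊗ V̄ → P is the same as a homomorphism V̄ → Hom(Q, P), hence a highest weight
vector of Hom(Q, P): a linear map ψ : Q → P with xψ(q) = ψ(xq) + wt(x)ψ(q) for x of nonnegative type
(`Verma.exists_tensor_lift`, `Verma.tensor_hom_ext`). A homomorphism out of the induced module is a
𝔟-equivariant map out of ℂ[t] (`Ind.exists_lift`, `Ind.induction`).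

On ℂ[s,t], d_0 is multiplication by s, and on polynomials without s the operator d_m - λ^m d_0 is
the scalar λ^m mγ. Since d_m v = 0 for m ≥ 1 and d_0 v = ηv, it acts on ℂ[t] ⊗ v as λ^m(mγ - η): so
p ↦ p ⊗ v is 𝔟-equivariant (`inTensor_subRep`) and gives F from the induced module to the tensor
product. Conversely s must go to d_0 - η, so ψ(s^k p(t)) = (d_0 - η)^k (1 ⊗ p); `lie_polyToInd`
verifies the highest weight condition for this ψ, which yields G in the other direction. That F and
G are mutually inverse is checked on generators. -/

noncomputable section

namespace AffineVirasoro

attribute [local instance 100] LieRing.ofAssociativeRing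

/-! ### Enveloping algebras and their modules. -/

section Enveloping

variable {L : Type*} [LieRing L] [LieAlgebra ℂ L]

/-- The canonical map corestricts to the subalgebra S generated by its image, so it lifts to U(L) →
S. Followed by the inclusion of S, the lift is the identity by uniqueness, hence S is everything. -/
theorem env_adjoin_range :
    Algebra.adjoin ℂ (Set.range (UniversalEnvelopingAlgebra.ι ℂ : L →ₗ⁅ℂ⁆ _)) = ⊤ := by
  set S := Algebra.adjoin ℂ (Set.range (UniversalEnvelopingAlgebra.ι ℂ : L →ₗ⁅ℂ⁆ _)) with hS
  let j : L →ₗ⁅ℂ⁆ S :=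
    { LinearMap.codRestrict (Subalgebra.toSubmodule S)
        (UniversalEnvelopingAlgebra.ι ℂ : L →ₗ⁅ℂ⁆ _).toLinearMap
        (fun x => Algebra.subset_adjoin ⟨x, rfl⟩) with
      map_lie' := fun {x y} => Subtype.ext ((UniversalEnvelopingAlgebra.ι ℂ).map_lie x y) }
  have H : S.val.comp (UniversalEnvelopingAlgebra.lift ℂ j) = AlgHom.id ℂ (UniversalEnvelopingAlgebra ℂ L) := by
    refine UniversalEnvelopingAlgebra.hom_ext ℂ ?_
    ext x
    change ((UniversalEnvelopingAlgebra.lift ℂ j (UniversalEnvelopingAlgebra.ι ℂ x) : S) :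
      UniversalEnvelopingAlgebra ℂ L) = UniversalEnvelopingAlgebra.ι ℂ x
    rw [UniversalEnvelopingAlgebra.lift_ι_apply]
    rfl
  refine eq_top_iff.2 fun u _ => ?_
  rw [show u = (UniversalEnvelopingAlgebra.lift ℂ j u : S) from (DFunLike.congr_fun H u).symm]
  exact (UniversalEnvelopingAlgebra.lift ℂ j u).2

/-- Induction on elements of the enveloping algebra by left multiplication with elements of the
Lie algebra. -/
theorem env_induction {p : UniversalEnvelopingAlgebra ℂ L → Prop} (one : p 1)
    (add : ∀ u w, p u → p w → p (u + w)) (smul : ∀ (r : ℂ) u, p u → p (r • u))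
    (mul : ∀ x u, p u → p (UniversalEnvelopingAlgebra.ι ℂ x * u))
    (u : UniversalEnvelopingAlgebra ℂ L) : p u := by
  have hu : u ∈ Algebra.adjoin ℂ
      (Set.range (UniversalEnvelopingAlgebra.ι ℂ : L →ₗ⁅ℂ⁆ _)) := by
    rw [env_adjoin_range]; trivial
  -- The property itself need not pass to products; stability of `p` under left multiplication by
  -- `u` does.
  have H : ∀ w, p w → p (u * w) := by
    induction hu using Algebra.adjoin_induction with
    | mem x hx => obtain ⟨x, rfl⟩ := hx; exact mul x
    | algebraMap r => intro w hw; rw [← Algebra.smul_def]; exact smul r w hw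
    | add u v _ _ h1 h2 => intro w hw; rw [add_mul]; exact add _ _ (h1 w hw) (h2 w hw)
    | mul u v _ _ h1 h2 => intro w hw; rw [mul_assoc]; exact h1 _ (h2 w hw)
  simpa using H 1 one

variable (P : Type*) [AddCommGroup P] [Module ℂ P] [LieRingModule L P] [LieModule ℂ L P]

/-- The action of the enveloping algebra on a Lie module. -/
def envEnd : UniversalEnvelopingAlgebra ℂ L →ₐ[ℂ] Module.End ℂ P :=
  UniversalEnvelopingAlgebra.lift ℂ (LieModule.toEnd ℂ L P)

theorem envEnd_ι (x : L) (p : P) : envEnd P (UniversalEnvelopingAlgebra.ι ℂ x) p = ⁅x, p⁆ := by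
  rw [envEnd, UniversalEnvelopingAlgebra.lift_ι_apply]
  rfl

/-- A Lie module, seen as a module over the enveloping algebra. -/
abbrev envModule : Module (UniversalEnvelopingAlgebra ℂ L) P :=
  Module.compHom P (envEnd (L := L) P).toRingHom

theorem envModule_isScalarTower :
    letI := envModule (L := L) P
    IsScalarTower ℂ (UniversalEnvelopingAlgebra ℂ L) P :=
  letI := envModule (L := L) P
  ⟨fun r u p => by
    change envEnd P (r • u) p = r • envEnd P u p
    rw [map_smul, LinearMap.smul_apply]⟩

variable {P}

/-! ### The induced module: generators and universal property. -/

section Ind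

attribute [local instance] LieRingModule.ofAssociativeModule

variable (K : LieSubalgebra ℂ L)
  {N : Type*} [AddCommGroup N] [Module ℂ N] (ρ : K →ₗ⁅ℂ⁆ Module.End ℂ N)

/-- The inclusion of `N` in the induced module. -/
def Ind.incl : N →ₗ[ℂ] Ind K ρ where
  toFun n := Ind.mk K ρ 1 n
  map_add' m n := by simp only [Ind.mk, TensorProduct.tmul_add]; rfl
  map_smul' r n := by simp only [Ind.mk, TensorProduct.tmul_smul]; rfl

/-- This is the balancing relation with u = 1 and x of degree one in U(K). -/
theorem Ind.lie_incl (x : K) (n : N) : ⁅(x : L), Ind.incl K ρ n⁆ = Ind.incl K ρ (ρ x n) := by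
  change Ind.mk K ρ (UniversalEnvelopingAlgebra.ι ℂ (x : L) * 1) n = Ind.mk K ρ 1 (ρ x n)
  refine (Submodule.Quotient.eq _).2 (Submodule.subset_span
    ⟨1, UniversalEnvelopingAlgebra.ι ℂ x, n, ?_⟩)
  rw [envIncl, envAct, UniversalEnvelopingAlgebra.lift_ι_apply,
    UniversalEnvelopingAlgebra.lift_ι_apply, mul_one, one_mul]
  rfl

/-- Expresses that 1 ⊗ N generates the induced module under the action of L. -/
theorem Ind.induction {p : Ind K ρ → Prop} (incl : ∀ n, p (Ind.incl K ρ n))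
    (add : ∀ u w, p u → p w → p (u + w)) (smul : ∀ (r : ℂ) u, p u → p (r • u))
    (lie : ∀ (x : L) u, p u → p ⁅x, u⁆) (w : Ind K ρ) : p w := by
  obtain ⟨w, rfl⟩ := Submodule.Quotient.mk_surjective _ w
  induction w using TensorProduct.induction_on with
  | zero =>
    have h0 := incl 0
    rw [map_zero] at h0
    exact h0
  | add u w h1 h2 => exact add _ _ h1 h2
  | tmul u n =>
    induction u using env_induction with
    | one => exact incl n
    | add u w h1 h2 => rw [TensorProduct.add_tmul]; exact add _ _ h1 h2
    | smul r u h1 => rw [← TensorProduct.smul_tmul']; exact smul r _ h1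
    | mul x u h1 => exact lie x _ h1

/-- The universal property of the induced module. -/
theorem Ind.exists_lift (φ : N →ₗ[ℂ] P) (hφ : ∀ (x : K) n, φ (ρ x n) = ⁅(x : L), φ n⁆) :
    ∃ F : Ind K ρ →ₗ⁅ℂ,L⁆ P, ∀ n, F (Ind.incl K ρ n) = φ n := by
  let := envModule (L := L) P
  have := envModule_isScalarTower (L := L) P
  have hι (x : L) (p : P) : UniversalEnvelopingAlgebra.ι ℂ x • p = ⁅x, p⁆ := envEnd_ι P x p
  -- Equivariance passes from K to U(K); this is what makes u ⊗ n ↦ u φ(n) respect the balancing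
  -- relations.
  have hφ' (x : UniversalEnvelopingAlgebra ℂ K) (n : N) :
      φ (envAct K ρ x n) = envIncl K x • φ n := by
    induction x using env_induction generalizing n with
    | one => simp
    | add u w h1 h2 => simp only [map_add, LinearMap.add_apply, h1, h2, add_smul]
    | smul r u h1 => simp only [map_smul, LinearMap.smul_apply, h1, smul_assoc]
    | mul x u h1 =>
      rw [map_mul, map_mul, mul_smul, ← h1, Module.End.mul_apply]
      have e1 : envAct K ρ (UniversalEnvelopingAlgebra.ι ℂ x) = ρ x :=
        UniversalEnvelopingAlgebra.lift_ι_apply ..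
      have e2 : envIncl K (UniversalEnvelopingAlgebra.ι ℂ x) =
          UniversalEnvelopingAlgebra.ι ℂ (x : L) :=
        UniversalEnvelopingAlgebra.lift_ι_apply ..
      rw [e1, e2, hι, hφ]
  let G : UniversalEnvelopingAlgebra ℂ L ⊗[ℂ] N →ₗ[UniversalEnvelopingAlgebra ℂ L] P :=
    TensorProduct.AlgebraTensorModule.lift
      { toFun := fun u => u • φ
        map_add' := fun u w => add_smul u w φ
        map_smul' := fun u w => mul_smul u w φ }
  have hG (u : UniversalEnvelopingAlgebra ℂ L) (n : N) : G (u ⊗ₜ n) = u • φ n := rfl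
  let F : Ind K ρ →ₗ[UniversalEnvelopingAlgebra ℂ L] P := (balancing K ρ).liftQ G <| by
    refine Submodule.span_le.2 ?_
    rintro _ ⟨u, x, n, rfl⟩
    change G _ = 0
    rw [map_sub, hG, hG, hφ', mul_smul, sub_self]
  refine ⟨{ F.restrictScalars ℂ with map_lie' := fun {x w} => ?_ }, fun n => ?_⟩
  · exact (F.map_smul (UniversalEnvelopingAlgebra.ι ℂ x) w).trans (hι x _)
  · exact one_smul (UniversalEnvelopingAlgebra ℂ L) (φ n)

end Ind

end Enveloping

/-! ### Verma modules: generation by the highest weight vector, homomorphisms, tensor products. -/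

section Verma

variable (η ε θ : ℂ)

theorem Verma.induction {p : Verma η ε θ → Prop} (one : p (Verma.mk η ε θ 1))
    (add : ∀ u w, p u → p w → p (u + w)) (smul : ∀ (r : ℂ) u, p u → p (r • u))
    (lie : ∀ (x : AffVir) u, p u → p ⁅x, u⁆) (w : Verma η ε θ) : p w := by
  obtain ⟨w, rfl⟩ := Submodule.Quotient.mk_surjective _ w
  induction w using env_induction with
  | one => exact one
  | add u w h1 h2 => exact add _ _ h1 h2
  | smul r u h1 => exact smul r _ h1
  | mul x u h1 => exact lie x _ h1

/-- The elements of the standard basis that act by scalars on a highest weight vector. -/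
inductive IsNonneg : Gen → Prop
  | e (n : ℕ) : IsNonneg (.e n)
  | f (n : ℕ) (hn : 1 ≤ n) : IsNonneg (.f n)
  | h (n : ℕ) : IsNonneg (.h n)
  | d (n : ℕ) : IsNonneg (.d n)
  | C : IsNonneg .C

/-- The highest weight. -/
def weight : Gen → ℂ
  | .h i => if i = 0 then ε else 0
  | .d i => if i = 0 then η else 0
  | .C => θ
  | .e _ => 0
  | .f _ => 0

theorem Verma.lie_highest {x : Gen} (hx : IsNonneg x) :
    ⁅basis x, Verma.mk η ε θ 1⁆ = weight η ε θ x • Verma.mk η ε θ 1 := by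
  have h0 {x : AffVir} (hx : toU x ∈ vermaIdeal η ε θ) : ⁅x, Verma.mk η ε θ 1⁆ = 0 := by
    rw [Verma.lie_mk, mul_one]
    exact (Submodule.Quotient.mk_eq_zero _).2 hx
  have h1 {x : AffVir} {r : ℂ} (hx : toU x - algebraMap ℂ UEnv r ∈ vermaIdeal η ε θ) :
      ⁅x, Verma.mk η ε θ 1⁆ = r • Verma.mk η ε θ 1 := by
    rw [Verma.lie_mk, mul_one]
    refine ((Submodule.Quotient.eq _).2 hx).trans ?_
    rw [Algebra.algebraMap_eq_smul_one]
    rfl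
  cases hx with
  | e n =>
    rw [weight, zero_smul]
    refine h0 (Submodule.subset_span (.inl ?_))
    rcases Nat.eq_zero_or_pos n with rfl | hn
    · exact .inl rfl
    · exact .inr ⟨n, by exact_mod_cast hn, .inl rfl⟩
  | f n hn =>
    rw [weight, zero_smul]
    exact h0 (Submodule.subset_span (.inl (.inr ⟨n, by exact_mod_cast hn, .inr (.inl rfl)⟩)))
  | h n =>
    rcases Nat.eq_zero_or_pos n with rfl | hn
    · exact h1 (Submodule.subset_span (.inr (.inr (.inl rfl))))
    · rw [weight, if_neg (by omega), zero_smul]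
      exact h0 (Submodule.subset_span
        (.inl (.inr ⟨n, by exact_mod_cast hn, .inr (.inr (.inl rfl))⟩)))
  | d n =>
    rcases Nat.eq_zero_or_pos n with rfl | hn
    · exact h1 (Submodule.subset_span (.inr (.inl rfl)))
    · rw [weight, if_neg (by omega), zero_smul]
      exact h0 (Submodule.subset_span
        (.inl (.inr ⟨n, by exact_mod_cast hn, .inr (.inr (.inr rfl))⟩)))
  | C => exact h1 (Submodule.subset_span (.inr (.inr (.inr rfl))))

variable {P : Type*} [AddCommGroup P] [Module ℂ P] [LieRingModule AffVir P] [LieModule ℂ AffVir P]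

/-- The universal property of the Verma module. -/
theorem Verma.exists_lift (w : P)
    (hw : ∀ x, IsNonneg x → ⁅basis x, w⁆ = weight η ε θ x • w) :
    ∃ F : Verma η ε θ →ₗ⁅ℂ,AffVir⁆ P, F (Verma.mk η ε θ 1) = w := by
  let := envModule (L := AffVir) P
  have := envModule_isScalarTower (L := AffVir) P
  have hι (x : AffVir) (p : P) : toU x • p = ⁅x, p⁆ := envEnd_ι P x p
  have h0 (x : Gen) (hx : IsNonneg x) (hr : weight η ε θ x = 0) : toU (basis x) • w = 0 := by
    rw [hι, hw x hx, hr, zero_smul]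
  have h1 (x : Gen) (hx : IsNonneg x) (r : ℂ) (hr : weight η ε θ x = r) :
      (toU (basis x) - algebraMap ℂ UEnv r) • w = 0 := by
    rw [sub_smul, hι, hw x hx, hr, algebraMap_smul, sub_self]
  -- The map u ↦ u w kills each generator of the left ideal, hence descends to the quotient.
  let F : Verma η ε θ →ₗ[UEnv] P :=
    (vermaIdeal η ε θ).liftQ (LinearMap.toSpanSingleton UEnv P w) <| by
      refine Submodule.span_le.2 ?_
      rintro _ ((rfl | ⟨i, hi, rfl | rfl | rfl | rfl⟩) | rfl | rfl | rfl)
      · exact h0 _ (.e 0) rfl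
      -- The ideal is indexed by integers at least 1, `IsNonneg` by naturals. The three scalar
      -- generators carry no index and are left unchanged.
      all_goals try lift i to ℕ using by omega
      · exact h0 _ (.e i) rfl
      · exact h0 _ (.f i (by omega)) rfl
      · exact h0 _ (.h i) (if_neg (by omega))
      · exact h0 _ (.d i) (if_neg (by omega))
      · exact h1 _ (.d 0) η (by simp [weight])
      · exact h1 _ (.h 0) ε (by simp [weight])
      · exact h1 _ .C θ rfl
  refine ⟨{ F.restrictScalars ℂ with map_lie' := fun {x w} => ?_ }, ?_⟩
  · exact (F.map_smul (toU x) w).trans (hι x _)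
  · exact one_smul UEnv w

/-- Homomorphisms from the tensor product of a module and a Verma module. -/
theorem Verma.exists_tensor_lift {Q : Type*} [AddCommGroup Q] [Module ℂ Q]
    [LieRingModule AffVir Q] [LieModule ℂ AffVir Q] (ψ : Q →ₗ[ℂ] P)
    (hψ : ∀ x, IsNonneg x → ∀ q, ⁅basis x, ψ q⁆ = ψ ⁅basis x, q⁆ + weight η ε θ x • ψ q) :
    ∃ F : Q ⊗[ℂ] Verma η ε θ →ₗ⁅ℂ,AffVir⁆ P, ∀ q, F (q ⊗ₜ Verma.mk η ε θ 1) = ψ q := by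
  -- The target here is Hom(Q, P) with (xψ)(q) = x ψ(q) - ψ(xq): the hypothesis on ψ says exactly
  -- that ψ is a highest weight vector of it.
  obtain ⟨G, hG⟩ := Verma.exists_lift η ε θ ψ fun x hx => LinearMap.ext fun q => by
    rw [LieHom.lie_apply, hψ x hx, add_sub_cancel_left, LinearMap.smul_apply]
  refine ⟨{ TensorProduct.lift (G : Verma η ε θ →ₗ[ℂ] Q →ₗ[ℂ] P).flip with
    map_lie' := fun {x z} => ?_ }, fun q => ?_⟩
  · induction z using TensorProduct.induction_on with
    | zero => simp
    | add z w h1 h2 => simp only [lie_add, map_add, AddHom.toFun_eq_coe] at h1 h2 ⊢; rw [h1, h2]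
    | tmul q v =>
      change TensorProduct.lift (G : Verma η ε θ →ₗ[ℂ] Q →ₗ[ℂ] P).flip ⁅x, q ⊗ₜ[ℂ] v⁆ = ⁅x, G v q⁆
      rw [TensorProduct.LieModule.lie_tmul_right, map_add]
      change G v ⁅x, q⁆ + G ⁅x, v⁆ q = _
      rw [LieModuleHom.map_lie, LieHom.lie_apply, add_sub_cancel]
  · exact LinearMap.congr_fun hG q

-- The identity q ⊗ xu = x(q ⊗ u) - xq ⊗ u moves the action off the Verma factor, so Q ⊗ v generates
-- the tensor product. Since xq replaces q, the induction must keep q arbitrary.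
omit [LieModule ℂ AffVir P] in
theorem Verma.tensor_hom_ext {Q : Type*} [AddCommGroup Q] [Module ℂ Q]
    [LieRingModule AffVir Q] [LieModule ℂ AffVir Q] {F G : Q ⊗[ℂ] Verma η ε θ →ₗ⁅ℂ,AffVir⁆ P}
    (hFG : ∀ q, F (q ⊗ₜ Verma.mk η ε θ 1) = G (q ⊗ₜ Verma.mk η ε θ 1)) : F = G := by
  have key (v : Verma η ε θ) : ∀ q, F (q ⊗ₜ v) = G (q ⊗ₜ v) := by
    induction v using Verma.induction with
    | one => exact hFG
    | add u w h1 h2 => intro q; rw [TensorProduct.tmul_add, map_add, map_add, h1, h2]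
    | smul r u h1 => intro q; rw [TensorProduct.tmul_smul, map_smul, map_smul, h1]
    | lie x u h1 =>
      intro q
      rw [← add_sub_cancel_left (⁅x, q⁆ ⊗ₜ[ℂ] u) (q ⊗ₜ[ℂ] ⁅x, u⁆),
        ← TensorProduct.LieModule.lie_tmul_right, map_sub, map_sub, LieModuleHom.map_lie,
        LieModuleHom.map_lie, h1, h1]
  refine LieModuleHom.ext fun z => ?_
  induction z using TensorProduct.induction_on with
  | zero => simp
  | add z w h1 h2 => rw [map_add, map_add, h1, h2]
  | tmul q v => exact key v q

end Verma

/-! ### The space ℂ[s,t] as polynomials in s over ℂ[t]. -/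

theorem monomial_eq (m : Fin 2 →₀ ℕ) (r : ℂ) :
    MvPolynomial.monomial m r =
      MvPolynomial.X 0 ^ m 0 * inT (r • (Polynomial.X : Polynomial ℂ) ^ m 1) := by
  rw [MvPolynomial.monomial_eq, Finsupp.prod_fintype _ _ (fun _ => pow_zero _), Fin.prod_univ_two,
    map_smul, map_pow, inT, Polynomial.aeval_X, MvPolynomial.smul_eq_C_mul]
  ring

/-- Induction on the exponent of s, the form suited to d_0 acting as multiplication by s. -/
theorem poly_induction {p : MvPolynomial (Fin 2) ℂ → Prop} (poly : ∀ q, p (inT q))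
    (add : ∀ u w, p u → p w → p (u + w)) (mul : ∀ q, p q → p (MvPolynomial.X 0 * q))
    (q : MvPolynomial (Fin 2) ℂ) : p q := by
  induction q using MvPolynomial.induction_on' with
  | add u w h1 h2 => exact add u w h1 h2
  | monomial m r =>
    rw [monomial_eq]
    induction m 0 with
    | zero => rw [pow_zero, one_mul]; exact poly _
    | succ k hk => rw [pow_succ', mul_assoc]; exact mul _ hk

section Extend

variable {W : Type*} [AddCommGroup W] [Module ℂ W] (D : Module.End ℂ W)
  (ψ : Polynomial ℂ →ₗ[ℂ] W)

/-- The linear map on `ℂ[s, t]` that extends `ψ` and turns multiplication by `s` into `D`. -/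
def extendPoly : MvPolynomial (Fin 2) ℂ →ₗ[ℂ] W :=
  (MvPolynomial.basisMonomials (Fin 2) ℂ).constr ℂ fun m => (D ^ m 0) (ψ (Polynomial.X ^ m 1))

theorem extendPoly_monomial (m : Fin 2 →₀ ℕ) (r : ℂ) :
    extendPoly D ψ (MvPolynomial.monomial m r) = (D ^ m 0) (ψ (r • Polynomial.X ^ m 1)) := by
  rw [show MvPolynomial.monomial m r = r • MvPolynomial.basisMonomials (Fin 2) ℂ m by
      simp [MvPolynomial.smul_monomial], map_smul, extendPoly, Module.Basis.constr_basis,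
    map_smul, map_smul]

theorem extendPoly_inT (p : Polynomial ℂ) : extendPoly D ψ (inT p) = ψ p := by
  induction p using Polynomial.induction_on' with
  | add p q h1 h2 => simp only [map_add, h1, h2]
  | monomial n r =>
    have H : inT (Polynomial.monomial n r) = MvPolynomial.monomial (Finsupp.single 1 n) r := by
      rw [monomial_eq, ← Polynomial.smul_X_eq_monomial]
      simp
    rw [H, extendPoly_monomial, ← Polynomial.smul_X_eq_monomial]
    simp

theorem extendPoly_X_mul (q : MvPolynomial (Fin 2) ℂ) :
    extendPoly D ψ (MvPolynomial.X 0 * q) = D (extendPoly D ψ q) := by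
  induction q using MvPolynomial.induction_on' with
  | add u w h1 h2 => simp only [mul_add, map_add, h1, h2]
  | monomial m r =>
    rw [MvPolynomial.X, MvPolynomial.monomial_mul, one_mul, extendPoly_monomial,
      extendPoly_monomial]
    simp [add_comm 1, pow_succ']

end Extend

/-! ### The map from the tensor product to the induced module. -/

section Main

variable (M : Family) (l a : ℂˣ) (b g η ε θ : ℂ)

/-- The map from `ℂ[s, t]` to the induced module that extends the inclusion of `ℂ[t]` and turns
multiplication by `s` into the action of `d_0 - η`. -/
def polyToInd : PolyMod M l a b g →ₗ[ℂ] IndMod M l a b g η ε θ :=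
  extendPoly (LieModule.toEnd ℂ AffVir (IndMod M l a b g η ε θ) (d 0) - η • LinearMap.id)
    (Ind.incl (subB l) (subRep M l a b g η ε θ))

theorem polyToInd_inT (p : Polynomial ℂ) :
    polyToInd M l a b g η ε θ (PolyMod.mk M l a b g (inT p)) =
      Ind.incl (subB l) (subRep M l a b g η ε θ) p :=
  extendPoly_inT _ _ p

theorem d_zero_lie_mk (q : MvPolynomial (Fin 2) ℂ) :
    ⁅d 0, PolyMod.mk M l a b g q⁆ = PolyMod.mk M l a b g (MvPolynomial.X 0 * q) := by
  rw [d_lie_mk]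
  have h0 : shiftST 0 0 q = q := by
    rw [show shiftST 0 0 = AlgHom.id ℂ _ from MvPolynomial.algHom_ext fun k => by
      fin_cases k <;> simp [shiftST]]
    rfl
  simp [h0]

theorem polyToInd_X_mul (q : MvPolynomial (Fin 2) ℂ) :
    polyToInd M l a b g η ε θ (PolyMod.mk M l a b g (MvPolynomial.X 0 * q)) =
      ⁅d 0, polyToInd M l a b g η ε θ (PolyMod.mk M l a b g q)⁆ -
        η • polyToInd M l a b g η ε θ (PolyMod.mk M l a b g q) :=
  extendPoly_X_mul (LieModule.toEnd ℂ AffVir (IndMod M l a b g η ε θ) (d 0) - η • LinearMap.id)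
    (Ind.incl (subB l) (subRep M l a b g η ε θ)) q

/-- The highest weight condition for d_0, which holds by construction: it is the reason for choosing
d_0 - η rather than d_0 as the image of s. -/
theorem lie_d_zero_polyToInd (q : PolyMod M l a b g) :
    ⁅d 0, polyToInd M l a b g η ε θ q⁆ =
      polyToInd M l a b g η ε θ ⁅d 0, q⁆ + η • polyToInd M l a b g η ε θ q := by
  have H (p : MvPolynomial (Fin 2) ℂ) :
      ⁅d 0, polyToInd M l a b g η ε θ (PolyMod.mk M l a b g p)⁆ =
        polyToInd M l a b g η ε θ ⁅d 0, PolyMod.mk M l a b g p⁆ +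
          η • polyToInd M l a b g η ε θ (PolyMod.mk M l a b g p) := by
    rw [d_zero_lie_mk, polyToInd_X_mul, sub_add_cancel]
  exact H q

theorem PolyMod.mk_add (p q : MvPolynomial (Fin 2) ℂ) :
    PolyMod.mk M l a b g (p + q) = PolyMod.mk M l a b g p + PolyMod.mk M l a b g q := rfl

theorem PolyMod.mk_smul (r : ℂ) (q : MvPolynomial (Fin 2) ℂ) :
    PolyMod.mk M l a b g (r • q) = r • PolyMod.mk M l a b g q := rfl

/-- On polynomials without s, the elements e_n, f_n, h_n and C lie in 𝔟, so the balancing relation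
applies directly. For d_n with n ≥ 1, write d_n = (d_n - λ^n d_0) + λ^n d_0; the -η in the 𝔟-action
cancels the η coming from d_0. -/
theorem lie_polyToInd_inT {x : Gen} (hx : IsNonneg x) (p : Polynomial ℂ) :
    ⁅basis x, polyToInd M l a b g η ε θ (PolyMod.mk M l a b g (inT p))⁆ =
      polyToInd M l a b g η ε θ ⁅basis x, PolyMod.mk M l a b g (inT p)⁆ +
        weight η ε θ x • polyToInd M l a b g η ε θ (PolyMod.mk M l a b g (inT p)) := by
  have hs (i : ℤ) (j : ℂ) : shiftST i j (inT p) = inT (shiftT j p) := shiftST_inT i j p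
  have hB {x : AffVir} (hx : IsSubGen l x) (p : Polynomial ℂ) :
      ⁅x, Ind.incl (subB l) (subRep M l a b g η ε θ) p⁆ =
        Ind.incl (subB l) (subRep M l a b g η ε θ)
          (subRep M l a b g η ε θ ⟨x, Submodule.subset_span hx⟩ p) :=
    Ind.lie_incl (subB l) (subRep M l a b g η ε θ) ⟨x, Submodule.subset_span hx⟩ p
  cases hx with
  | e n =>
    change ⁅e n, _⁆ = polyToInd M l a b g η ε θ ⁅e n, _⁆ + _
    rw [e_lie_mk, hs, ← map_mul, ← map_smul, polyToInd_inT, polyToInd_inT, hB (.e n), subRep_e,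
      weight, zero_smul, add_zero, zpow_natCast]
  | f n hn =>
    change ⁅f n, _⁆ = polyToInd M l a b g η ε θ ⁅f n, _⁆ + _
    rw [f_lie_mk, hs, ← map_mul, ← map_smul, polyToInd_inT, polyToInd_inT, hB (.f n hn),
      subRep_f (hm := hn), weight, zero_smul, add_zero, zpow_natCast]
  | h n =>
    change ⁅h n, _⁆ = polyToInd M l a b g η ε θ ⁅h n, _⁆ + _
    rw [h_lie_mk, hs, shiftT_zero, show MvPolynomial.X 1 = inT Polynomial.X by simp [inT],
      ← map_mul, ← map_smul, polyToInd_inT, polyToInd_inT, hB (.h n), subRep_h,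
      ← map_smul, ← map_add, zpow_natCast, weight]
    congr 1
    -- The constant ε occurs only for n = 0, in the 𝔟-action as in the highest weight.
    rcases Nat.eq_zero_or_pos n with rfl | hn
    · simp [add_mul, Polynomial.smul_eq_C_mul]
    · rw [if_neg (by omega), if_neg (by omega)]
      simp
  | d n =>
    change ⁅d n, _⁆ = polyToInd M l a b g η ε θ ⁅d n, _⁆ + _
    rcases Nat.eq_zero_or_pos n with rfl | hn
    · exact lie_d_zero_polyToInd M l a b g η ε θ _
    · have H0 := lie_d_zero_polyToInd M l a b g η ε θ (PolyMod.mk M l a b g (inT p))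
      have H := hB (.d n hn) p
      rw [subRep_d (hm := hn), sub_lie, smul_lie, ← polyToInd_inT, sub_eq_iff_eq_add, H0, d_zero_lie_mk,
        map_smul, ← polyToInd_inT] at H
      rw [H, d_lie_mk, hs, shiftT_zero, weight, if_neg (by omega), add_mul, smul_add, zpow_natCast,
        ← MvPolynomial.smul_eq_C_mul]
      simp only [PolyMod.mk_add, PolyMod.mk_smul, map_add, map_smul]
      push_cast
      module
  | C =>
    change ⁅c, _⁆ = polyToInd M l a b g η ε θ ⁅c, _⁆ + _
    rw [c_lie_mk, polyToInd_inT, hB .c, subRep_c, map_smul, weight, map_zero, zero_add]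

/-- Induction on the exponent of s. Passing from q to sq = d_0 q commutes x past d_0, which is
harmless because basis vectors are eigenvectors of ad d_0 and the weight vanishes off the eigenvalue
zero. -/
theorem lie_polyToInd {x : Gen} (hx : IsNonneg x) (q : PolyMod M l a b g) :
    ⁅basis x, polyToInd M l a b g η ε θ q⁆ = polyToInd M l a b g η ε θ ⁅basis x, q⁆ +
      weight η ε θ x • polyToInd M l a b g η ε θ q := by
  -- Here j is minus the index of x, and 0 for C; the weight is nonzero only at h_0, d_0 and C,
  -- where j = 0.
  obtain ⟨j, hj, hw⟩ : ∃ j : ℂ, ⁅basis x, d 0⁆ = j • basis x ∧ j * weight η ε θ x = 0 := by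
    have sw (y : AffVir) (j : ℂ) (hy : ⁅d 0, y⁆ = j • y) : ⁅y, d 0⁆ = (-j) • y := by
      rw [← lie_skew, hy, neg_smul]
    cases hx with
    | e n => exact ⟨-n, sw (e n) n (by rw [lie_d_e]; simp), by simp [weight]⟩
    | f n => exact ⟨-n, sw (f n) n (by rw [lie_d_f]; simp), by simp [weight]⟩
    | h n => exact ⟨-n, sw (h n) n (by rw [lie_d_h]; simp), by simp [weight]; tauto⟩
    | d n => exact ⟨-n, sw (d n) n (by rw [lie_d_d]; simp), by simp [weight]; tauto⟩
    | C => exact ⟨0, (c_lie _).trans (zero_smul ℂ _).symm, zero_mul _⟩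
  induction q using poly_induction with
  | poly p => exact lie_polyToInd_inT M l a b g η ε θ hx p
  | add u w h1 h2 =>
    change ⁅basis x, polyToInd M l a b g η ε θ (PolyMod.mk M l a b g u + PolyMod.mk M l a b g w)⁆ =
      polyToInd M l a b g η ε θ ⁅basis x, PolyMod.mk M l a b g u + PolyMod.mk M l a b g w⁆ +
        weight η ε θ x • polyToInd M l a b g η ε θ (PolyMod.mk M l a b g u + PolyMod.mk M l a b g w)
    rw [map_add, lie_add, lie_add, map_add, smul_add, add_add_add_comm]
    exact congrArg₂ (· + ·) h1 h2
  | mul q hq =>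
    change ⁅basis x, polyToInd M l a b g η ε θ (PolyMod.mk M l a b g q)⁆ =
      polyToInd M l a b g η ε θ ⁅basis x, PolyMod.mk M l a b g q⁆ +
        weight η ε θ x • polyToInd M l a b g η ε θ (PolyMod.mk M l a b g q) at hq
    change ⁅basis x, polyToInd M l a b g η ε θ (PolyMod.mk M l a b g (MvPolynomial.X 0 * q))⁆ =
      polyToInd M l a b g η ε θ ⁅basis x, PolyMod.mk M l a b g (MvPolynomial.X 0 * q)⁆ +
        weight η ε θ x • polyToInd M l a b g η ε θ (PolyMod.mk M l a b g (MvPolynomial.X 0 * q))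
    rw [← d_zero_lie_mk, leibniz_lie, hj, smul_lie]
    have H := fun q => lie_d_zero_polyToInd M l a b g η ε θ q
    have H' : ∀ q, polyToInd M l a b g η ε θ ⁅d 0, q⁆ =
      ⁅d 0, polyToInd M l a b g η ε θ q⁆ - η • polyToInd M l a b g η ε θ q :=
      fun q => by rw [H, add_sub_cancel_right]
    rw [map_add, map_smul, H', H', lie_sub, lie_smul, leibniz_lie (basis x), hj, smul_lie, hq,
      lie_add, lie_smul]
    -- The only discrepancy: [x, d_0] = jx applied to ψ(q) gives jψ(xq) plus this term, whereas
    -- ψ([x, d_0]q) gives jψ(xq) alone.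
    have e0 : (j * weight η ε θ x) •
      polyToInd M l a b g η ε θ (PolyMod.mk M l a b g q) = 0 := by rw [hw, zero_smul]
    rw [smul_add, smul_smul j, e0]
    module

/-! ### The map from the induced module to the tensor product. -/

theorem lie_tmul_highest {x : Gen} (hx : IsNonneg x) (q : PolyMod M l a b g) :
    ⁅basis x, q ⊗ₜ[ℂ] Verma.mk η ε θ 1⁆ =
      (⁅basis x, q⁆ + weight η ε θ x • q) ⊗ₜ[ℂ] Verma.mk η ε θ 1 := by
  rw [TensorProduct.LieModule.lie_tmul_right, Verma.lie_highest η ε θ hx,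
    TensorProduct.tmul_smul, TensorProduct.add_tmul, TensorProduct.smul_tmul']

/-- The inclusion of `ℂ[t]` in the tensor product with the Verma module. -/
def inTensor : Polynomial ℂ →ₗ[ℂ] PolyMod M l a b g ⊗[ℂ] Verma η ε θ :=
  (TensorProduct.mk ℂ (PolyMod M l a b g) (Verma η ε θ)).flip (Verma.mk η ε θ 1) ∘ₗ
    inT.toLinearMap

theorem inTensor_apply (p : Polynomial ℂ) :
    inTensor M l a b g η ε θ p = PolyMod.mk M l a b g (inT p) ⊗ₜ Verma.mk η ε θ 1 := rfl

/-- The space ℂ[t] ⊗ v is 𝔟-stable because s cancels in d_m - λ^m d_0: it acts by λ^m(s + mγ) -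
λ^m(s + η). Using `subLin`, which is defined on all of 𝔏, avoids membership proofs when this is
extended linearly to 𝔟. -/
theorem inTensor_subLin {x : AffVir} (hx : IsSubGen l x) (p : Polynomial ℂ) :
    inTensor M l a b g η ε θ (subLin M l a b g η ε θ x p) =
      ⁅x, inTensor M l a b g η ε θ p⁆ := by
  have hs (i : ℤ) (j : ℂ) : shiftST i j (inT p) = inT (shiftT j p) := shiftST_inT i j p
  have hlie {x : Gen} (hx : IsNonneg x) := lie_tmul_highest M l a b g η ε θ hx
    (PolyMod.mk M l a b g (inT p))
  cases hx with
  | e n =>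
    refine (congrArg _ (subRep_e M l a b g η ε θ n p)).trans (Eq.trans ?_ (hlie (.e n)).symm)
    change _ = (⁅e n, _⁆ + _) ⊗ₜ _
    rw [e_lie_mk, hs, ← map_mul, ← map_smul, weight, zero_smul, add_zero, zpow_natCast]
    rfl
  | f n hn =>
    refine (congrArg _ (subRep_f M l a b g η ε θ n hn p)).trans
      (Eq.trans ?_ (hlie (.f n hn)).symm)
    change _ = (⁅f n, _⁆ + _) ⊗ₜ _
    rw [f_lie_mk, hs, ← map_mul, ← map_smul, weight, zero_smul, add_zero, zpow_natCast]
    rfl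
  | h n =>
    refine (congrArg _ (subRep_h M l a b g η ε θ n p)).trans (Eq.trans ?_ (hlie (.h n)).symm)
    change _ = (⁅h n, _⁆ + _) ⊗ₜ _
    rw [h_lie_mk, hs, shiftT_zero, show MvPolynomial.X 1 = inT Polynomial.X by simp [inT],
      ← map_mul, ← map_smul, zpow_natCast, weight]
    rw [inTensor_apply, ← PolyMod.mk_smul, ← PolyMod.mk_add, ← map_smul, ← map_add]
    congr 3
    rcases Nat.eq_zero_or_pos n with rfl | hn
    · simp [add_mul, Polynomial.smul_eq_C_mul]
    · rw [if_neg (by omega), if_neg (by omega)]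
      simp
  | d n hn =>
    refine (congrArg _ (subRep_d M l a b g η ε θ n hn p)).trans ?_
    have h1 := hlie (.d n)
    have h0 := hlie (.d 0)
    change ⁅d n, _⁆ = (⁅d n, _⁆ + _) ⊗ₜ _ at h1
    change ⁅d 0, _⁆ = (⁅d 0, _⁆ + _) ⊗ₜ _ at h0
    rw [weight, if_neg (by omega), zero_smul, add_zero, d_lie_mk, hs, shiftT_zero] at h1
    rw [weight, if_pos (by simp), d_zero_lie_mk] at h0
    rw [sub_lie, smul_lie, inTensor_apply M l a b g η ε θ p, h1, h0, TensorProduct.smul_tmul',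
      ← TensorProduct.sub_tmul, map_smul, inTensor_apply, TensorProduct.smul_tmul']
    congr 1
    rw [zpow_natCast, add_mul, ← MvPolynomial.smul_eq_C_mul]
    simp only [PolyMod.mk_add, PolyMod.mk_smul]
    push_cast
    module
  | c =>
    refine (congrArg _ (subRep_c M l a b g η ε θ p)).trans (Eq.trans ?_ (hlie .C).symm)
    change _ = (⁅c, _⁆ + _) ⊗ₜ _
    rw [c_lie_mk, zero_add, weight, map_smul, inTensor_apply, TensorProduct.smul_tmul']

theorem inTensor_subRep (x : subB l) (p : Polynomial ℂ) :
    inTensor M l a b g η ε θ (subRep M l a b g η ε θ x p) =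
      ⁅(x : AffVir), inTensor M l a b g η ε θ p⁆ := by
  obtain ⟨x, hx⟩ := x
  change inTensor M l a b g η ε θ (subLin M l a b g η ε θ x p) = ⁅x, _⁆
  change x ∈ Submodule.span ℂ {z | IsSubGen l z} at hx
  induction hx using Submodule.span_induction with
  | mem x hx => exact inTensor_subLin M l a b g η ε θ hx p
  | zero => simp
  | add x y _ _ h1 h2 => rw [map_add, LinearMap.add_apply, map_add, h1, h2, add_lie]
  | smul r x _ h1 => rw [map_smul, LinearMap.smul_apply, map_smul, h1, smul_lie]

/-! ### The two maps are mutually inverse. -/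

theorem nonempty_tensor_equiv_ind :
    Nonempty ((PolyMod M l a b g ⊗[ℂ] Verma η ε θ) ≃ₗ⁅ℂ, AffVir⁆ IndMod M l a b g η ε θ) := by
  obtain ⟨G, hG⟩ := Verma.exists_tensor_lift η ε θ (polyToInd M l a b g η ε θ)
    fun x hx q => lie_polyToInd M l a b g η ε θ hx q
  obtain ⟨F, hF⟩ := Ind.exists_lift (subB l) (subRep M l a b g η ε θ)
    (inTensor M l a b g η ε θ) (inTensor_subRep M l a b g η ε θ)
  have hGφ (p : Polynomial ℂ) : G (inTensor M l a b g η ε θ p) = Ind.incl (subB l) (subRep M l a b g η ε θ) p :=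
    (hG _).trans (polyToInd_inT M l a b g η ε θ p)
  have hGF (w : IndMod M l a b g η ε θ) : G (F w) = w := by
    induction w using Ind.induction with
    | incl p => rw [hF, hGφ]
    | add u w h1 h2 => rw [map_add, map_add, h1, h2]
    | smul r u h1 => rw [map_smul, map_smul, h1]
    | lie x u h1 => rw [LieModuleHom.map_lie, LieModuleHom.map_lie, h1]
  -- F is known only on the image of ℂ[t], while ℂ[s,t] ⊗ v is needed to identify F ∘ G; the powers
  -- of s are supplied by the equivariance of F under d_0.
  have hFψ (q : MvPolynomial (Fin 2) ℂ) : F (polyToInd M l a b g η ε θ (PolyMod.mk M l a b g q)) =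
      PolyMod.mk M l a b g q ⊗ₜ Verma.mk η ε θ 1 := by
    induction q using poly_induction with
    | poly p => rw [polyToInd_inT, hF]; rfl
    | add u w h1 h2 =>
      change F (polyToInd M l a b g η ε θ (PolyMod.mk M l a b g u + PolyMod.mk M l a b g w)) =
        (PolyMod.mk M l a b g u + PolyMod.mk M l a b g w) ⊗ₜ Verma.mk η ε θ 1
      rw [map_add, map_add, h1, h2, TensorProduct.add_tmul]
    | mul q h1 =>
      have H := lie_d_zero_polyToInd M l a b g η ε θ (PolyMod.mk M l a b g q)
      have H' := lie_tmul_highest M l a b g η ε θ (.d 0) (PolyMod.mk M l a b g q)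
      change ⁅d 0, _⁆ = (⁅d 0, _⁆ + _) ⊗ₜ[ℂ] _ at H'
      have H2 := congrArg F H
      rw [LieModuleHom.map_lie, h1, H', map_add, map_smul, h1, d_zero_lie_mk,
        TensorProduct.add_tmul, ← TensorProduct.smul_tmul', weight, if_pos (by simp)] at H2
      -- Both sides of `H2` carry the same summand η(q ⊗ v), from d_0 v = ηv on one and from the
      -- shift by η in ψ on the other.
      exact (add_right_cancel H2).symm
  have hFG : F.comp G = LieModuleHom.id := Verma.tensor_hom_ext η ε θ fun q => by
    rw [LieModuleHom.comp_apply, hG]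
    exact hFψ q
  exact ⟨{ G with
    invFun := F
    left_inv := fun z => LieModuleHom.congr_fun hFG z
    right_inv := hGF }⟩

end Main

end AffineVirasoro

end

theorem theorem6p3 (l a : ℂˣ) (b g η ε θ : ℂ) :
    Nonempty ((AffineVirasoro.PolyMod .Omega l a b g ⊗[ℂ] AffineVirasoro.Verma η ε θ)
      ≃ₗ⁅ℂ, AffineVirasoro.AffVir⁆ AffineVirasoro.IndMod .Omega l a b g η ε θ) ∧
    Nonempty ((AffineVirasoro.PolyMod .Delta l a b g ⊗[ℂ] AffineVirasoro.Verma η ε θ)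
      ≃ₗ⁅ℂ, AffineVirasoro.AffVir⁆ AffineVirasoro.IndMod .Delta l a b g η ε θ) ∧
    Nonempty ((AffineVirasoro.PolyMod .Theta l a b g ⊗[ℂ] AffineVirasoro.Verma η ε θ)
      ≃ₗ⁅ℂ, AffineVirasoro.AffVir⁆ AffineVirasoro.IndMod .Theta l a b g η ε θ) :=
  ⟨AffineVirasoro.nonempty_tensor_equiv_ind .Omega l a b g η ε θ,
    AffineVirasoro.nonempty_tensor_equiv_ind .Delta l a b g η ε θ,
    AffineVirasoro.nonempty_tensor_equiv_ind .Theta l a b g η ε θ⟩
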